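/- Let $K$ be an infinite field of characteristic $p$ and let $n$ be an integer with $4 \le n \le p$. All algebras are associative and unital. Put $[x_1,x_2]=x_1x_2-x_2x_1$ and $[x_1,\dots,x_m]=[[x_1,\dots,x_{m-1}],x_m]$; for a $K$-algebra $A$ let $T^{(m)}(A)$ be the two-sided ideal of $A$ generated by all elements $[a_1,\dots,a_m]$ with $a_i\in A$. Let $F$ be the free associative $K$-algebra on $x_1,x_2,\dots$, let $F^{(n)}=F/T^{(n)}(F)$, and let $A=F_2^{(n)}$ be the subalgebra of $F^{(n)}$ generated by the images of $x_1,x_2$. A T-space of $A$ is a $K$-subspace of $A$ that is invariant under all $K$-algebra endomorphisms of $A$; the T-space generated by a set $S\subseteq A$ is the smallest T-space containing $S$. Then there is a finite strictly decreasing chain $$T^{(3)}(A)=T_1\supset T_2\supset\dots\supset T_k\supset T_{k+1}=0$$ of T-spaces of $A$, each of which is a two-sided ideal of $A$, such that no factor $T_i/T_{i+1}$ contains a proper T-space; that is, every T-space $W$ of $A$ with $T_{i+1}\subseteq W\subseteq T_i$ equals $T_{i+1}$ or $T_i$ $(1\le i\le k)$. In particular, every T-space of $A$ contained in $T^{(3)}(A)$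 is generated, as a T-space, by a finite set. -/

import Mathlib

namespace LieNilpotent

section General

variable (K : Type*) [Field K] (A : Type*) [Ring A] [Algebra K A]

/-- The commutator `[x 0, …, x (n-1)]` of degree `n`, defined by
`[x_1, …, x_n] = [[x_1, …, x_{n-1}], x_n]` (only the degrees `n ≥ 2` matter). -/
def longComm {A : Type*} [Ring A] (x : ℕ → A) : ℕ → A
  | 0 => 0
  | 1 => x 0
  | k + 2 => ⁅longComm x (k + 1), x (k + 1)⁆

/-- The T-ideal `f^T` of the algebra `A` generated by the noncommutative polynomial `f`:
the two-sided ideal generated by all values of `f` in `A`. -/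
def verbalIdeal (f : FreeAlgebra K ℕ) : TwoSidedIdeal A :=
  TwoSidedIdeal.span (Set.range fun φ : FreeAlgebra K ℕ →ₐ[K] A => φ f)

/-- `T^{(n)}(A)`: the T-ideal of `A` generated by the commutator `[x_1, …, x_n]`. -/
def lieIdeal (n : ℕ) : TwoSidedIdeal A :=
  verbalIdeal K A (longComm (FreeAlgebra.ι K) n)

/-- `T^{(n)}(A)` as a `K`-subspace of `A`. -/
def lieSubmodule (n : ℕ) : Submodule K A :=
  (TwoSidedIdeal.asIdeal (lieIdeal K A n)).restrictScalars K

variable {K A}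

/-- A T-space of `A`: a `K`-subspace invariant under all endomorphisms of the unital
`K`-algebra `A`. -/
def IsTSpace (U : Submodule K A) : Prop :=
  ∀ φ : A →ₐ[K] A, ∀ u ∈ U, φ u ∈ U

/-- The subspace `U` is a two-sided ideal of `A`. -/
def IsIdeal (U : Submodule K A) : Prop :=
  ∀ a : A, ∀ u ∈ U, a * u ∈ U ∧ u * a ∈ U

/-- The T-space of `A` generated by the set `S`; see `isLeast_tSpan`. -/
def tSpan (S : Set A) : Submodule K A :=
  Submodule.span K {a | ∃ φ : A →ₐ[K] A, ∃ s ∈ S, a = φ s}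

theorem isLeast_tSpan (S : Set A) :
    IsLeast {U : Submodule K A | IsTSpace U ∧ S ⊆ U} (tSpan S) := by
  refine ⟨⟨?_, ?_⟩, ?_⟩
  · intro ψ u hu
    have h : tSpan S ≤ (tSpan S : Submodule K A).comap ψ.toLinearMap := by
      refine Submodule.span_le.2 ?_
      rintro _ ⟨φ, s, hs, rfl⟩
      exact Submodule.subset_span ⟨ψ.comp φ, s, hs, rfl⟩
    exact h hu
  · intro s hs
    exact Submodule.subset_span ⟨AlgHom.id K A, s, hs, rfl⟩
  · rintro U ⟨hU, hS⟩
    refine Submodule.span_le.2 ?_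
    rintro _ ⟨φ, s, hs, rfl⟩
    exact hU φ s (hS hs)

/-- The T-space `U` has a finite system of generators. -/
def IsFinitelyGenerated (U : Submodule K A) : Prop :=
  ∃ S : Finset A, U = tSpan (S : Set A)

/-- `U = T 0 ⊃ T 1 ⊃ … ⊃ T k = 0` is a T-composition series of the T-space `U`: a strictly
decreasing chain of T-spaces such that no factor `T i / T (i+1)` contains a proper T-space.
T-spaces of the factor correspond to T-spaces `W` with `T (i+1) ⊆ W ⊆ T i`. -/
structure IsTCompositionSeries (U : Submodule K A) (k : ℕ)
    (T : Fin (k + 1) → Submodule K A) : Prop where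
  first : T 0 = U
  last : T (Fin.last k) = ⊥
  isTSpace : ∀ i, IsTSpace (T i)
  strict : ∀ i : Fin k, T i.succ < T i.castSucc
  simple_factor : ∀ i : Fin k, ∀ W : Submodule K A, IsTSpace W →
    T i.succ ≤ W → W ≤ T i.castSucc → W = T i.succ ∨ W = T i.castSucc

/-- A T-composition series is T-normal if all its members are ideals of `A`. -/
structure IsTNormalSeries (U : Submodule K A) (k : ℕ)
    (T : Fin (k + 1) → Submodule K A) : Prop extends IsTCompositionSeries U k T where
  isIdeal : ∀ i, IsIdeal (T i)

end General

section RelativelyFree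

variable (K : Type*) [Field K]

/-- `F^{(n)} = F / T^{(n)}`, where `F` is the free unital associative algebra of countable rank. -/
abbrev RelFree (n : ℕ) : Type _ :=
  (lieIdeal K (FreeAlgebra K ℕ) n).ringCon.Quotient

/-- The image in `F^{(n)}` of the `i`-th free generator. -/
def RelFree.gen (n i : ℕ) : RelFree K n :=
  (lieIdeal K (FreeAlgebra K ℕ) n).ringCon.mk' (FreeAlgebra.ι K i)

/-- `F_2^{(n)}`: the unital subalgebra of `F^{(n)}` generated by the first two generators. -/
def RelFreeTwo (n : ℕ) : Subalgebra K (RelFree K n) :=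
  Algebra.adjoin K {RelFree.gen K n 0, RelFree.gen K n 1}

end RelativelyFree

end LieNilpotent

namespace LieNilpotent

/-! ### Commutator identities -/

section Bracket

variable {K A : Type*} [Field K] [Ring A] [Algebra K A] (a b c : A)

/-! Filter `A` by weight: `propFil e` consists of the sums of products of commutators of total
degree at least `e`, with arbitrary coefficients. Modulo weight `e + 1`, an element of weight `e` is
a combination of products `x ^ i * y ^ j * c` with `c` in the finite-dimensional space `properSpace`
of proper elements of degree `e`, built from commutators in the letters `x`, `y` only
(`propFil_le_monoSpan`).

For two generators and `2 ≠ 0` one has `T^(j+1) T^(k+1) ⊆ T^(j+k+1)`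
(`commIdeal_mul_commIdeal_mem`). Hence `T^(3)` is the term of weight 3, the filtration reaches 0,
and a nonzero proper element of bidegree `(a, b)` has `a, b < n ≤ p`.

The main claim concerns a T-space `W` between the terms of weight `e + 1` and `e`, where `e ≥ 3`:
modulo the smaller term, `W` is spanned by the monomial multiples of its own proper elements. So `W`
is an ideal, it is determined by a subspace of a finite-dimensional space, and the interval can be
refined to a finite chain with simple factors.

One inclusion (`tSpace_le_monoSpan`) uses translations of `x` and `y`, which fix proper elements:
over an infinite field the coefficients of the translated element stay in `W`, and the top one is
proper. For the other (`mono_mul_mem_of_left`), endomorphisms `x ↦ x + r f` differentiate to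
derivations preserving `W`. On proper elements these act through a Jacobian, and combining two of
them isolates a monomial multiple of `c` with the factor `2a(1 - a)`. It is nonzero if `2 ≤ a < p`,
and `a + b ≥ 3` makes `a` or `b` at least 2. -/

theorem lie_add : ⁅a, b + c⁆ = ⁅a, b⁆ + ⁅a, c⁆ := by simp only [Ring.lie_def]; noncomm_ring

theorem add_lie : ⁅a + b, c⁆ = ⁅a, c⁆ + ⁅b, c⁆ := by simp only [Ring.lie_def]; noncomm_ring

theorem lie_swap : ⁅a, b⁆ = -⁅b, a⁆ := by simp only [Ring.lie_def]; noncomm_ring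

@[simp] theorem zero_lie : ⁅(0 : A), a⁆ = 0 := by simp [Ring.lie_def]

@[simp] theorem lie_zero : ⁅a, (0 : A)⁆ = 0 := by simp [Ring.lie_def]

@[simp] theorem lie_self : ⁅a, a⁆ = 0 := by simp [Ring.lie_def]

theorem lie_smul (r : K) : ⁅a, r • b⁆ = r • ⁅a, b⁆ := by simp [Ring.lie_def, smul_sub]

theorem smul_lie (r : K) : ⁅r • a, b⁆ = r • ⁅a, b⁆ := by simp [Ring.lie_def, smul_sub]

theorem lie_algebraMap_right (r : K) : ⁅a, algebraMap K A r⁆ = 0 := by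
  rw [Ring.lie_def, Algebra.commutes, sub_self]

theorem lie_algebraMap_left (r : K) : ⁅algebraMap K A r, a⁆ = 0 := by
  rw [Ring.lie_def, Algebra.commutes, sub_self]

theorem lie_mul : ⁅a, b * c⁆ = ⁅a, b⁆ * c + b * ⁅a, c⁆ := by
  simp only [Ring.lie_def]; noncomm_ring

theorem mul_lie : ⁅a * b, c⁆ = a * ⁅b, c⁆ + ⁅a, c⁆ * b := by
  simp only [Ring.lie_def]; noncomm_ring

theorem map_lie {F B : Type*} [Ring B] [FunLike F A B] [RingHomClass F A B] (φ : F) :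
    φ ⁅a, b⁆ = ⁅φ a, φ b⁆ := by
  simp only [Ring.lie_def, map_sub, map_mul]

end Bracket

/-! ### Products and brackets of the commutator ideals in a two-generated algebra -/

section LowerCentral

variable (K : Type*) [Field K] (A : Type*) [Ring A] [Algebra K A]

/-- The span of the commutators `[a_0, …, a_d]` of degree `d + 1`. -/
def lowerComm : ℕ → Submodule K A
  | 0 => ⊤
  | d + 1 => Submodule.span K {z | ∃ u ∈ lowerComm d, ∃ a, z = ⁅u, a⁆}

/-- The ideal generated by the commutators of degree `d + 1`, described as a left ideal. -/
def commIdeal (d : ℕ) : Submodule K A :=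
  Submodule.span K {z | ∃ a : A, ∃ u ∈ lowerComm K A d, z = a * u}

variable {K A}

theorem lie_mem_lowerComm {d : ℕ} {u : A} (hu : u ∈ lowerComm K A d) (a : A) :
    ⁅u, a⁆ ∈ lowerComm K A (d + 1) :=
  Submodule.subset_span ⟨u, hu, a, rfl⟩

theorem lowerComm_succ_le (d : ℕ) : lowerComm K A (d + 1) ≤ lowerComm K A d := by
  induction d with
  | zero => exact le_top
  | succ d ih =>
    refine Submodule.span_le.2 ?_
    rintro _ ⟨u, hu, a, rfl⟩
    exact lie_mem_lowerComm (ih hu) a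

theorem mul_mem_commIdeal' {d : ℕ} (a : A) {u : A} (hu : u ∈ lowerComm K A d) :
    a * u ∈ commIdeal K A d :=
  Submodule.subset_span ⟨a, u, hu, rfl⟩

theorem lowerComm_le_commIdeal (d : ℕ) : lowerComm K A d ≤ commIdeal K A d := fun u hu => by
  simpa using mul_mem_commIdeal' (1 : A) hu

theorem mem_commIdeal_zero (a : A) : a ∈ commIdeal K A 0 :=
  lowerComm_le_commIdeal 0 (Submodule.mem_top)

theorem commIdeal_induction {d : ℕ} {P : A → Prop} (h0 : P 0)
    (hadd : ∀ a b, P a → P b → P (a + b)) (hmul : ∀ a, ∀ u ∈ lowerComm K A d, P (a * u))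
    {z : A} (hz : z ∈ commIdeal K A d) : P z := by
  induction hz using Submodule.closure_induction with
  | zero => exact h0
  | add a b _ _ ha hb => exact hadd a b ha hb
  | smul_mem r z hz =>
    obtain ⟨a, u, hu, rfl⟩ := hz
    rw [← smul_mul_assoc]
    exact hmul _ u hu

theorem lowerComm_induction {d : ℕ} {P : A → Prop} (h0 : P 0)
    (hadd : ∀ a b, P a → P b → P (a + b)) (hlie : ∀ u ∈ lowerComm K A d, ∀ a, P ⁅u, a⁆)
    {z : A} (hz : z ∈ lowerComm K A (d + 1)) : P z := by
  induction hz using Submodule.closure_induction with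
  | zero => exact h0
  | add a b _ _ ha hb => exact hadd a b ha hb
  | smul_mem r z hz =>
    obtain ⟨u, hu, a, rfl⟩ := hz
    rw [← lie_smul]
    exact hlie u hu _

theorem mul_mem_commIdeal {d : ℕ} (a : A) {m : A} (hm : m ∈ commIdeal K A d) :
    a * m ∈ commIdeal K A d := by
  refine commIdeal_induction (P := fun m => a * m ∈ commIdeal K A d) (by simp) ?_ ?_ hm
  · intro b c hb hc
    rw [mul_add]
    exact add_mem hb hc
  · intro b u hu
    rw [← mul_assoc]
    exact mul_mem_commIdeal' _ hu

theorem commIdeal_mul_mem {d : ℕ} {m : A} (hm : m ∈ commIdeal K A d) (a : A) :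
    m * a ∈ commIdeal K A d := by
  refine commIdeal_induction (P := fun m => m * a ∈ commIdeal K A d) (by simp) ?_ ?_ hm
  · intro b c hb hc
    rw [add_mul]
    exact add_mem hb hc
  · intro b u hu
    have h : b * u * a = b * a * u + b * ⁅u, a⁆ := by simp only [Ring.lie_def]; noncomm_ring
    rw [h]
    exact add_mem (mul_mem_commIdeal' _ hu)
      (mul_mem_commIdeal' _ (lowerComm_succ_le d (lie_mem_lowerComm hu a)))

theorem commIdeal_succ_le (d : ℕ) : commIdeal K A (d + 1) ≤ commIdeal K A d := by
  refine Submodule.span_le.2 ?_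
  rintro _ ⟨a, u, hu, rfl⟩
  exact mul_mem_commIdeal' a (lowerComm_succ_le d hu)

theorem lie_mem_commIdeal_one (a b : A) : ⁅a, b⁆ ∈ commIdeal K A 1 :=
  lowerComm_le_commIdeal 1 (lie_mem_lowerComm Submodule.mem_top b)

theorem gen_induction {x y : A} (hgen : Algebra.adjoin K {x, y} = ⊤) {P : A → Prop} (hx : P x)
    (hy : P y) (halg : ∀ r : K, P (algebraMap K A r)) (hadd : ∀ a b, P a → P b → P (a + b))
    (hmul : ∀ a b, P a → P b → P (a * b)) (a : A) : P a := by
  have ha : a ∈ Algebra.adjoin K {x, y} := hgen ▸ Algebra.mem_top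
  induction ha using Algebra.adjoin_induction with
  | mem z hz =>
    rcases hz with rfl | hz
    · exact hx
    · rw [Set.mem_singleton_iff.1 hz]; exact hy
  | algebraMap r => exact halg r
  | add a b _ _ ha hb => exact hadd a b ha hb
  | mul a b _ _ ha hb => exact hmul a b ha hb

variable {x y : A} (hgen : Algebra.adjoin K {x, y} = ⊤) (h2 : (2 : K) ≠ 0)

include h2 in
-- Expanding `[[u, x²], y]` produces `[u, x][x, y] + [x, y][u, x]` modulo the ideal. Interchanging
-- the two factors costs only a longer commutator, so twice the product lies in the ideal.
theorem lie_self_mul_mem {d : ℕ} {u : A} (hu : u ∈ lowerComm K A d) (x y : A) :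
    ⁅u, x⁆ * ⁅x, y⁆ ∈ commIdeal K A (d + 2) := by
  have h : (2 : K) • (⁅u, x⁆ * ⁅x, y⁆) = ⁅⁅u, x * x⁆, y⁆ - ⁅⁅u, x⁆, y⁆ * x - x * ⁅⁅u, x⁆, y⁆
      + ⁅⁅u, x⁆, ⁅x, y⁆⁆ := by
    rw [two_smul]; simp only [Ring.lie_def]; noncomm_ring
  have hux := lie_mem_lowerComm hu x
  have huxy := lowerComm_le_commIdeal _ (lie_mem_lowerComm hux y)
  have h' : (2 : K) • (⁅u, x⁆ * ⁅x, y⁆) ∈ commIdeal K A (d + 2) := by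
    rw [h]
    refine add_mem (sub_mem (sub_mem ?_ ?_) ?_) ?_
    · exact lowerComm_le_commIdeal _ (lie_mem_lowerComm (lie_mem_lowerComm hu _) _)
    · exact commIdeal_mul_mem huxy _
    · exact mul_mem_commIdeal _ huxy
    · exact lowerComm_le_commIdeal _ (lie_mem_lowerComm hux _)
  exact (Submodule.smul_mem_iff _ h2).1 h'

include hgen h2 in
-- Having two generators matters here: the Leibniz rule reduces `a` in `[u, a][x, y]` to `x` or `y`,
-- and either letter is repeated in `[x, y]`.
theorem lowerComm_mul_lie_gen_mem {d : ℕ} {u : A} (hu : u ∈ lowerComm K A (d + 1)) :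
    u * ⁅x, y⁆ ∈ commIdeal K A (d + 2) := by
  refine lowerComm_induction (P := fun u => u * ⁅x, y⁆ ∈ commIdeal K A (d + 2)) (by simp) ?_ ?_ hu
  · intro a b ha hb
    rw [add_mul]; exact add_mem ha hb
  · intro u hu a
    refine gen_induction hgen (P := fun a => ⁅u, a⁆ * ⁅x, y⁆ ∈ commIdeal K A (d + 2))
      (lie_self_mul_mem h2 hu x y) ?_ ?_ ?_ ?_ a
    · rw [lie_swap x y, mul_neg]
      exact neg_mem (lie_self_mul_mem h2 hu y x)
    · intro r; simp [lie_algebraMap_right]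
    · intro a b ha hb
      rw [lie_add, add_mul]; exact add_mem ha hb
    · intro a b ha hb
      have h : ⁅u, a * b⁆ * ⁅x, y⁆ = b * (⁅u, a⁆ * ⁅x, y⁆) + ⁅⁅u, a⁆, b⁆ * ⁅x, y⁆
          + a * (⁅u, b⁆ * ⁅x, y⁆) := by
        simp only [Ring.lie_def]; noncomm_ring
      rw [h]
      exact add_mem (add_mem (mul_mem_commIdeal _ ha) (commIdeal_mul_mem (lowerComm_le_commIdeal _
        (lie_mem_lowerComm (lie_mem_lowerComm hu _) _)) _)) (mul_mem_commIdeal _ hb)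

include hgen h2 in
theorem lowerComm_mul_lie_mem {d : ℕ} {u : A} (hu : u ∈ lowerComm K A (d + 1)) (a b : A) :
    u * ⁅a, b⁆ ∈ commIdeal K A (d + 2) := by
  have key : ∀ c : A, (∀ u ∈ lowerComm K A (d + 1), u * ⁅x, c⁆ ∈ commIdeal K A (d + 2)) →
      (∀ u ∈ lowerComm K A (d + 1), u * ⁅y, c⁆ ∈ commIdeal K A (d + 2)) →
      ∀ a : A, ∀ u ∈ lowerComm K A (d + 1), u * ⁅a, c⁆ ∈ commIdeal K A (d + 2) := by
    intro c hx hy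
    refine gen_induction hgen hx hy ?_ ?_ ?_
    · intro r u _; simp [lie_algebraMap_left]
    · intro a b ha hb u hu
      rw [add_lie, mul_add]; exact add_mem (ha u hu) (hb u hu)
    · intro a b ha hb u hu
      have h : u * ⁅a * b, c⁆ = a * (u * ⁅b, c⁆) + ⁅u, a⁆ * ⁅b, c⁆ + u * ⁅a, c⁆ * b := by
        simp only [Ring.lie_def]; noncomm_ring
      rw [h]
      exact add_mem (add_mem (mul_mem_commIdeal _ (hb u hu)) (commIdeal_mul_mem
        (lowerComm_le_commIdeal _ (lie_mem_lowerComm hu _)) _)) (commIdeal_mul_mem (ha u hu) _)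
  have swap : ∀ a b u : A, u * ⁅a, b⁆ ∈ commIdeal K A (d + 2) →
      u * ⁅b, a⁆ ∈ commIdeal K A (d + 2) := by
    intro a b u h
    rw [lie_swap, mul_neg]
    exact neg_mem h
  have hxy : ∀ u ∈ lowerComm K A (d + 1), u * ⁅x, y⁆ ∈ commIdeal K A (d + 2) :=
    fun u hu => lowerComm_mul_lie_gen_mem hgen h2 hu
  have hax := key x (by simp) (fun u hu => swap _ _ _ (hxy u hu))
  have hay := key y hxy (by simp)
  exact key b (fun u hu => swap _ _ _ (hax b u hu)) (fun u hu => swap _ _ _ (hay b u hu)) a u hu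

include hgen h2 in
-- By the Leibniz rule the only new term in `[a u, b]` is `[a, b] u`; up to a longer commutator it
-- is `u [a, b]`, settled by `lowerComm_mul_lie_mem`.
theorem lie_mem_commIdeal {d : ℕ} {m : A} (hm : m ∈ commIdeal K A d) (b : A) :
    ⁅m, b⁆ ∈ commIdeal K A (d + 1) := by
  rcases d with _ | d
  · exact lie_mem_commIdeal_one m b
  refine commIdeal_induction (P := fun m => ⁅m, b⁆ ∈ commIdeal K A (d + 2)) (by simp) ?_ ?_ hm
  · intro a c ha hc
    rw [add_lie]; exact add_mem ha hc
  · intro a u hu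
    have h : ⁅a * u, b⁆ = a * ⁅u, b⁆ + u * ⁅a, b⁆ - ⁅u, ⁅a, b⁆⁆ := by
      simp only [Ring.lie_def]; noncomm_ring
    rw [h]
    exact sub_mem (add_mem (mul_mem_commIdeal' _ (lie_mem_lowerComm hu _))
      (lowerComm_mul_lie_mem hgen h2 hu _ _)) (lowerComm_le_commIdeal _ (lie_mem_lowerComm hu _))

include hgen h2 in
theorem lie_lowerComm_mem {k : ℕ} : ∀ {j : ℕ} {m l : A}, m ∈ commIdeal K A j →
    l ∈ lowerComm K A k → ⁅m, l⁆ ∈ commIdeal K A (j + k + 1) := by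
  induction k with
  | zero => intro j m l hm _; exact lie_mem_commIdeal hgen h2 hm l
  | succ k ih =>
    intro j m l hm hl
    refine lowerComm_induction (P := fun l => ⁅m, l⁆ ∈ commIdeal K A (j + (k + 1) + 1)) (by simp)
      ?_ ?_ hl
    · intro a b ha hb
      rw [lie_add]; exact add_mem ha hb
    · intro u hu a
      have h : ⁅m, ⁅u, a⁆⁆ = ⁅⁅m, u⁆, a⁆ - ⁅⁅m, a⁆, u⁆ := by
        simp only [Ring.lie_def]; noncomm_ring
      rw [h]
      have e : j + 1 + k + 1 = j + (k + 1) + 1 := by omega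
      exact sub_mem (lie_mem_commIdeal hgen h2 (ih hm hu) a)
        (e ▸ ih (lie_mem_commIdeal hgen h2 hm a) hu)

include hgen h2 in
-- The identity `m[u, a] = [m, u]a - [ma, u]` turns a product into brackets, whose degrees are
-- already controlled.
theorem commIdeal_mul_lowerComm_mem {j k : ℕ} {m l : A} (hm : m ∈ commIdeal K A j)
    (hl : l ∈ lowerComm K A k) : m * l ∈ commIdeal K A (j + k) := by
  rcases k with _ | k
  · exact commIdeal_mul_mem hm l
  refine lowerComm_induction (P := fun l => m * l ∈ commIdeal K A (j + (k + 1))) (by simp) ?_ ?_ hl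
  · intro a b ha hb
    rw [mul_add]; exact add_mem ha hb
  · intro u hu a
    have h : m * ⁅u, a⁆ = ⁅m, u⁆ * a - ⁅m * a, u⁆ := by
      simp only [Ring.lie_def]; noncomm_ring
    rw [h]
    exact sub_mem (commIdeal_mul_mem (lie_lowerComm_mem hgen h2 hm hu) a)
      (lie_lowerComm_mem hgen h2 (commIdeal_mul_mem hm a) hu)

include hgen h2 in
theorem commIdeal_mul_commIdeal_mem {j k : ℕ} {m l : A} (hm : m ∈ commIdeal K A j)
    (hl : l ∈ commIdeal K A k) : m * l ∈ commIdeal K A (j + k) := by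
  refine commIdeal_induction (P := fun l => m * l ∈ commIdeal K A (j + k)) (by simp) ?_ ?_ hl
  · intro a b ha hb
    rw [mul_add]; exact add_mem ha hb
  · intro a u hu
    rw [← mul_assoc]
    exact commIdeal_mul_lowerComm_mem hgen h2 (commIdeal_mul_mem hm a) hu

end LowerCentral

/-! ### The weight filtration and proper elements -/

section Filtration

/-- The multiplicative filtration of a ring for which passing to commutators raises the degree:
`PropFil e` consists of sums of products of commutators of total degree at least `e`. -/
inductive PropFil {A : Type*} [Ring A] : ℕ → A → Prop
  | base (a : A) : PropFil 0 a
  | zero (e : ℕ) : PropFil e 0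
  | add {e : ℕ} {a b : A} : PropFil e a → PropFil e b → PropFil e (a + b)
  | mul {e e' : ℕ} {a b : A} : PropFil e a → PropFil e' b → PropFil (e + e') (a * b)
  | comm (a b : A) : PropFil 2 ⁅a, b⁆
  | lie {e : ℕ} {a : A} (b : A) : PropFil e a → PropFil (e + 1) ⁅a, b⁆
  | mono {e : ℕ} {a : A} : PropFil (e + 1) a → PropFil e a

theorem PropFil.mul_left {A : Type*} [Ring A] {e : ℕ} {a : A} (b : A) (h : PropFil e a) :
    PropFil e (b * a) := by
  simpa using (PropFil.base b).mul h

/-- `PropFil e` as a subspace. -/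
def propFil (K A : Type*) [Field K] [Ring A] [Algebra K A] (e : ℕ) : Submodule K A where
  carrier := {a | PropFil e a}
  add_mem' := PropFil.add
  zero_mem' := PropFil.zero e
  smul_mem' r a h := by
    rw [Algebra.smul_def]
    exact h.mul_left _

/-- Proper elements of bidegree `(a, b)`: the span of products of commutators in the letters `x`
and `y`, with `a` occurrences of `x` and `b` occurrences of `y`. -/
inductive IsProper (K : Type*) {A : Type*} [Field K] [Ring A] [Algebra K A] (x y : A) :
    ℕ → ℕ → A → Prop
  | zero (a b : ℕ) : IsProper K x y a b 0
  | add {a b : ℕ} {c c' : A} :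
      IsProper K x y a b c → IsProper K x y a b c' → IsProper K x y a b (c + c')
  | smul {a b : ℕ} {c : A} (r : K) : IsProper K x y a b c → IsProper K x y a b (r • c)
  | one : IsProper K x y 0 0 1
  | comm : IsProper K x y 1 1 ⁅x, y⁆
  | mul {a b a' b' : ℕ} {c c' : A} : IsProper K x y a b c → IsProper K x y a' b' c' →
      IsProper K x y (a + a') (b + b') (c * c')
  | lie_left {a b : ℕ} {c : A} : IsProper K x y a b c → IsProper K x y (a + 1) b ⁅c, x⁆
  | lie_right {a b : ℕ} {c : A} : IsProper K x y a b c → IsProper K x y a (b + 1) ⁅c, y⁆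

variable {K A : Type*} [Field K] [Ring A] [Algebra K A]

theorem mem_propFil {e : ℕ} {a : A} : a ∈ propFil K A e ↔ PropFil e a := Iff.rfl

theorem propFil_mul_mem {e e' : ℕ} {a b : A} (ha : a ∈ propFil K A e) (hb : b ∈ propFil K A e') :
    a * b ∈ propFil K A (e + e') := PropFil.mul ha hb

theorem mul_mem_propFil {e : ℕ} (a : A) {b : A} (hb : b ∈ propFil K A e) :
    a * b ∈ propFil K A e := PropFil.mul_left a hb

theorem propFil_mul_mem' {e : ℕ} {a : A} (ha : a ∈ propFil K A e) (b : A) :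
    a * b ∈ propFil K A e := PropFil.mul ha (PropFil.base b)

theorem lie_mem_propFil {e : ℕ} {a : A} (ha : a ∈ propFil K A e) (b : A) :
    ⁅a, b⁆ ∈ propFil K A (e + 1) := PropFil.lie b ha

theorem comm_mem_propFil (a b : A) : ⁅a, b⁆ ∈ propFil K A 2 := PropFil.comm a b

theorem propFil_succ_le (e : ℕ) : propFil K A (e + 1) ≤ propFil K A e := fun _ h => PropFil.mono h

theorem propFil_antitone : Antitone (propFil K A) := antitone_nat_of_succ_le propFil_succ_le

theorem mem_propFil_zero (a : A) : a ∈ propFil K A 0 := PropFil.base a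

theorem isTSpace_propFil (e : ℕ) : IsTSpace (propFil K A e) := by
  intro φ u hu
  rw [mem_propFil] at hu ⊢
  induction hu with
  | base a => exact PropFil.base _
  | zero e => rw [map_zero]; exact PropFil.zero e
  | add _ _ ha hb => rw [map_add]; exact ha.add hb
  | mul _ _ ha hb => rw [map_mul]; exact ha.mul hb
  | comm a b => rw [map_lie]; exact PropFil.comm _ _
  | lie b _ ha => rw [map_lie]; exact ha.lie _
  | mono _ ha => exact ha.mono

variable {x y : A}

theorem IsProper.mem_propFil {a b : ℕ} {c : A} (h : IsProper K x y a b c) :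
    c ∈ propFil K A (a + b) := by
  induction h with
  | zero a b => exact zero_mem _
  | add _ _ h h' => exact add_mem h h'
  | smul r _ h => exact Submodule.smul_mem _ r h
  | one => exact mem_propFil_zero 1
  | comm => exact comm_mem_propFil x y
  | mul _ _ h h' =>
    have := propFil_mul_mem h h'
    rwa [add_add_add_comm] at this
  | lie_left _ h =>
    have := lie_mem_propFil h x
    rwa [add_right_comm] at this
  | lie_right _ h => exact lie_mem_propFil h y

theorem IsProper.mem_pow {a b : ℕ} {c : A} (h : IsProper K x y a b c) :
    c ∈ (Submodule.span K {1, x, y}) ^ (a + b) := by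
  have hx : x ∈ Submodule.span K ({1, x, y} : Set A) := Submodule.subset_span (by simp)
  have hy : y ∈ Submodule.span K ({1, x, y} : Set A) := Submodule.subset_span (by simp)
  have hl : ∀ {e : ℕ} {c z : A}, c ∈ (Submodule.span K ({1, x, y} : Set A)) ^ e →
      z ∈ Submodule.span K ({1, x, y} : Set A) →
      ⁅c, z⁆ ∈ (Submodule.span K ({1, x, y} : Set A)) ^ (e + 1) := by
    intro e c z hc hz
    rw [Ring.lie_def]
    refine sub_mem ?_ ?_
    · rw [pow_succ]; exact Submodule.mul_mem_mul hc hz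
    · rw [pow_succ']; exact Submodule.mul_mem_mul hz hc
  induction h with
  | zero a b => exact zero_mem _
  | add _ _ h h' => exact add_mem h h'
  | smul r _ h => exact Submodule.smul_mem _ r h
  | one => rw [add_zero, pow_zero]; exact Submodule.one_le.1 le_rfl
  | comm => exact hl (by simpa using hx) hy
  | mul _ _ h h' => rw [add_add_add_comm, pow_add]; exact Submodule.mul_mem_mul h h'
  | lie_left _ h => rw [add_right_comm]; exact hl h hx
  | lie_right _ h => rw [← add_assoc]; exact hl h hy

/-- The proper elements of total degree `e`. -/
def properSpace (K : Type*) {A : Type*} [Field K] [Ring A] [Algebra K A] (x y : A) (e : ℕ) :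
    Submodule K A :=
  Submodule.span K {c | ∃ a b, a + b = e ∧ IsProper K x y a b c}

/-- The span of the elements `x ^ i * y ^ j * c` with `c ∈ C`. -/
def monoSpan {K A : Type*} [Field K] [Ring A] [Algebra K A] (x y : A) (C : Submodule K A) :
    Submodule K A :=
  Submodule.span K {z | ∃ i j : ℕ, ∃ c ∈ C, z = x ^ i * y ^ j * c}

theorem properSpace_le_propFil (e : ℕ) : properSpace K x y e ≤ propFil K A e := by
  refine Submodule.span_le.2 ?_
  rintro c ⟨a, b, rfl, h⟩
  exact h.mem_propFil

/-- A proper element of degree `e` is a noncommutative polynomial of degree at most `e` in `x` and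
`y`. -/
instance finiteDimensional_properSpace (e : ℕ) : FiniteDimensional K (properSpace K x y e) := by
  have hle : properSpace K x y e ≤ (Submodule.span K {1, x, y}) ^ e := by
    refine Submodule.span_le.2 ?_
    rintro c ⟨a, b, rfl, h⟩
    exact h.mem_pow
  have hfg : ((Submodule.span K ({1, x, y} : Set A)) ^ e).FG :=
    Submodule.FG.pow (Submodule.fg_span (by simp)) e
  have : FiniteDimensional K ↥((Submodule.span K ({1, x, y} : Set A)) ^ e) :=
    Module.Finite.iff_fg.2 hfg
  exact Submodule.finiteDimensional_of_le hle

variable (hgen : Algebra.adjoin K {x, y} = ⊤)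

include hgen in
-- Modulo commutators the letters commute, so every word can be sorted into `x ^ i * y ^ j`.
theorem exists_sub_mem_propFil_two (a : A) :
    ∃ m ∈ Submodule.span K {z : A | ∃ i j : ℕ, z = x ^ i * y ^ j}, a - m ∈ propFil K A 2 := by
  have hmono : ∀ i j : ℕ, x ^ i * y ^ j ∈ Submodule.span K {z : A | ∃ i j : ℕ, z = x ^ i * y ^ j} :=
    fun i j => Submodule.subset_span ⟨i, j, rfl⟩
  suffices h : a ∈ Submodule.span K {z : A | ∃ i j : ℕ, z = x ^ i * y ^ j} ⊔ propFil K A 2 by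
    obtain ⟨m, hm, h, hh, rfl⟩ := Submodule.mem_sup.1 h
    exact ⟨m, hm, by simpa using hh⟩
  refine gen_induction hgen ?_ ?_ ?_ (fun a b => add_mem) ?_ a
  · exact Submodule.mem_sup_left (by simpa using hmono 1 0)
  · exact Submodule.mem_sup_left (by simpa using hmono 0 1)
  · intro r
    rw [Algebra.algebraMap_eq_smul_one]
    exact Submodule.mem_sup_left (Submodule.smul_mem _ _ (by simpa using hmono 0 0))
  · intro a b ha hb
    obtain ⟨m, hm, h, hh, rfl⟩ := Submodule.mem_sup.1 ha
    obtain ⟨m', hm', h', hh', rfl⟩ := Submodule.mem_sup.1 hb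
    have e : (m + h) * (m' + h') = m * m' + (m * h' + h * (m' + h')) := by noncomm_ring
    rw [e]
    refine add_mem ?_ (Submodule.mem_sup_right
      (add_mem (mul_mem_propFil _ hh') (propFil_mul_mem' hh _)))
    have hmul := Submodule.mul_mem_mul hm hm'
    rw [Submodule.span_mul_span] at hmul
    refine Submodule.span_le.2 ?_ hmul
    rintro _ ⟨_, ⟨i, j, rfl⟩, _, ⟨k, l, rfl⟩, rfl⟩
    have e : x ^ i * y ^ j * (x ^ k * y ^ l) = x ^ (i + k) * y ^ (j + l)
        + x ^ i * ⁅y ^ j, x ^ k⁆ * y ^ l := by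
      simp only [Ring.lie_def, pow_add]; noncomm_ring
    refine SetLike.mem_coe.2 ?_
    simp only [e]
    exact add_mem (Submodule.mem_sup_left (hmono _ _)) (Submodule.mem_sup_right
      (propFil_mul_mem' (mul_mem_propFil _ (comm_mem_propFil _ _)) _))

include hgen in
theorem mul_mem_monoSpan {e : ℕ} {C : Submodule K A} (hC : C ≤ propFil K A e) (a : A) {c : A}
    (hc : c ∈ C) : a * c ∈ monoSpan x y C ⊔ propFil K A (e + 1) := by
  obtain ⟨m, hm, h⟩ := exists_sub_mem_propFil_two hgen a
  have e1 : a * c = m * c + (a - m) * c := by noncomm_ring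
  rw [e1]
  refine add_mem (Submodule.mem_sup_left ?_) (Submodule.mem_sup_right
    (propFil_antitone (by omega) (propFil_mul_mem h (hC hc))))
  clear h e1
  induction hm using Submodule.span_induction with
  | mem z hz => obtain ⟨i, j, rfl⟩ := hz; exact Submodule.subset_span ⟨i, j, c, hc, rfl⟩
  | zero => simp
  | add a b _ _ ha hb => rw [add_mul]; exact add_mem ha hb
  | smul r a _ ha => rw [smul_mul_assoc]; exact Submodule.smul_mem _ _ ha

/-- Combinations of proper elements of degree `e`, modulo the next step of the filtration. -/
def leading (K : Type*) {A : Type*} [Field K] [Ring A] [Algebra K A] (x y : A) (e : ℕ) :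
    Submodule K A :=
  Submodule.span K ({z | ∃ a : A, ∃ c ∈ properSpace K x y e, z = a * c} ∪ propFil K A (e + 1))

theorem mem_leading_of_proper {e : ℕ} (a : A) {c : A} (hc : c ∈ properSpace K x y e) :
    a * c ∈ leading K x y e := Submodule.subset_span (Or.inl ⟨a, c, hc, rfl⟩)

theorem mem_leading_of_mem {e : ℕ} {h : A} (hh : h ∈ propFil K A (e + 1)) :
    h ∈ leading K x y e := Submodule.subset_span (Or.inr hh)

theorem leading_le_propFil (e : ℕ) : leading K x y e ≤ propFil K A e := by
  refine Submodule.span_le.2 ?_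
  rintro _ (⟨a, c, hc, rfl⟩ | h)
  · exact mul_mem_propFil a (properSpace_le_propFil e hc)
  · exact propFil_succ_le e h

theorem mul_mem_leading {e : ℕ} (a : A) {q : A} (hq : q ∈ leading K x y e) :
    a * q ∈ leading K x y e := by
  induction hq using Submodule.span_induction with
  | mem z hz =>
    rcases hz with ⟨b, c, hc, rfl⟩ | hz
    · rw [← mul_assoc]; exact mem_leading_of_proper _ hc
    · exact mem_leading_of_mem (mul_mem_propFil a hz)
  | zero => simp
  | add b c _ _ hb hc => rw [mul_add]; exact add_mem hb hc
  | smul r b _ hb => rw [mul_smul_comm]; exact Submodule.smul_mem _ _ hb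

theorem leading_mul_mem {e : ℕ} {q : A} (hq : q ∈ leading K x y e) (a : A) :
    q * a ∈ leading K x y e := by
  have h : q * a = a * q + ⁅q, a⁆ := by simp only [Ring.lie_def]; noncomm_ring
  rw [h]
  exact add_mem (mul_mem_leading a hq)
    (mem_leading_of_mem (lie_mem_propFil (leading_le_propFil e hq) a))

theorem properSpace_mul_mem {e e' : ℕ} {c c' : A} (hc : c ∈ properSpace K x y e)
    (hc' : c' ∈ properSpace K x y e') : c * c' ∈ properSpace K x y (e + e') := by
  have h := Submodule.mul_mem_mul hc hc'
  rw [properSpace, properSpace, Submodule.span_mul_span] at h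
  rw [properSpace]
  refine Submodule.span_mono ?_ h
  rintro _ ⟨c, ⟨a, b, rfl, hp⟩, c', ⟨a', b', rfl, hp'⟩, rfl⟩
  exact ⟨_, _, by omega, hp.mul hp'⟩

theorem leading_mul_leading_mem {e e' : ℕ} {q q' : A} (hq : q ∈ leading K x y e)
    (hq' : q' ∈ leading K x y e') : q * q' ∈ leading K x y (e + e') := by
  have h := Submodule.mul_mem_mul hq hq'
  rw [leading, leading, Submodule.span_mul_span] at h
  refine Submodule.span_le.2 ?_ h
  rintro _ ⟨q, hq, q', hq', rfl⟩
  refine SetLike.mem_coe.2 ?_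
  rcases hq with ⟨a, c, hc, rfl⟩ | hq
  · rcases hq' with ⟨a', c', hc', rfl⟩ | hq'
    · have e1 : a * c * (a' * c') = a * a' * (c * c') + a * ⁅c, a'⁆ * c' := by
        simp only [Ring.lie_def]; noncomm_ring
      simp only [e1]
      refine add_mem (mem_leading_of_proper _ (properSpace_mul_mem hc hc')) (mem_leading_of_mem ?_)
      have := propFil_mul_mem (e' := e') (mul_mem_propFil a
        (lie_mem_propFil (properSpace_le_propFil e hc) a'))
        (properSpace_le_propFil e' hc')
      rwa [add_right_comm] at this
    · exact mem_leading_of_mem (propFil_mul_mem (e := e) (e' := e' + 1)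
        (mul_mem_propFil a (properSpace_le_propFil e hc)) hq')
  · have : q' ∈ propFil K A e' :=
      leading_le_propFil (x := x) (y := y) e' (Submodule.subset_span hq')
    refine mem_leading_of_mem ?_
    have := propFil_mul_mem hq this
    rwa [add_right_comm] at this

theorem lie_left_mem_properSpace {e : ℕ} {c : A} (hc : c ∈ properSpace K x y e) :
    ⁅c, x⁆ ∈ properSpace K x y (e + 1) := by
  induction hc using Submodule.span_induction with
  | mem c hc =>
    obtain ⟨a, b, rfl, h⟩ := hc
    exact Submodule.subset_span ⟨_, _, by omega, h.lie_left⟩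
  | zero => simp
  | add b c _ _ hb hc => rw [add_lie]; exact add_mem hb hc
  | smul r b _ hb => rw [smul_lie]; exact Submodule.smul_mem _ _ hb

theorem lie_right_mem_properSpace {e : ℕ} {c : A} (hc : c ∈ properSpace K x y e) :
    ⁅c, y⁆ ∈ properSpace K x y (e + 1) := by
  induction hc using Submodule.span_induction with
  | mem c hc =>
    obtain ⟨a, b, rfl, h⟩ := hc
    exact Submodule.subset_span ⟨_, _, by omega, h.lie_right⟩
  | zero => simp
  | add b c _ _ hb hc => rw [add_lie]; exact add_mem hb hc
  | smul r b _ hb => rw [smul_lie]; exact Submodule.smul_mem _ _ hb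

include hgen in
theorem lie_proper_mem_leading {e : ℕ} {c : A} (hc : c ∈ properSpace K x y e) (b : A) :
    ⁅c, b⁆ ∈ leading K x y (e + 1) := by
  refine gen_induction hgen (P := fun b => ⁅c, b⁆ ∈ leading K x y (e + 1)) ?_ ?_ ?_ ?_ ?_ b
  · simpa using mem_leading_of_proper 1 (lie_left_mem_properSpace hc)
  · simpa using mem_leading_of_proper 1 (lie_right_mem_properSpace hc)
  · intro r; simp [lie_algebraMap_right]
  · intro a b ha hb; rw [lie_add]; exact add_mem ha hb
  · intro a b ha hb
    rw [lie_mul]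
    exact add_mem (leading_mul_mem ha b) (mul_mem_leading a hb)

include hgen in
theorem lie_mem_leading {e : ℕ} {q : A} (hq : q ∈ leading K x y e) (b : A) :
    ⁅q, b⁆ ∈ leading K x y (e + 1) := by
  induction hq using Submodule.span_induction with
  | mem z hz =>
    rcases hz with ⟨a, c, hc, rfl⟩ | hz
    · rw [mul_lie]
      refine add_mem (mul_mem_leading a (lie_proper_mem_leading hgen hc b)) (mem_leading_of_mem ?_)
      exact propFil_antitone (by omega)
        (propFil_mul_mem (comm_mem_propFil a b) (properSpace_le_propFil e hc))
    · exact mem_leading_of_mem (lie_mem_propFil hz b)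
  | zero => simp
  | add b c _ _ hb hc => rw [add_lie]; exact add_mem hb hc
  | smul r b _ hb => rw [smul_lie]; exact Submodule.smul_mem _ _ hb

include hgen in
theorem comm_mem_leading (a b : A) : ⁅a, b⁆ ∈ leading K x y 2 := by
  have hxy : ⁅x, y⁆ ∈ leading K x y 2 := by
    rw [← one_mul ⁅x, y⁆]
    exact mem_leading_of_proper 1 (Submodule.subset_span ⟨1, 1, rfl, IsProper.comm⟩)
  have key : ∀ c : A, ⁅x, c⁆ ∈ leading K x y 2 → ⁅y, c⁆ ∈ leading K x y 2 →
      ∀ a : A, ⁅a, c⁆ ∈ leading K x y 2 := by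
    intro c hx hy a
    refine gen_induction hgen (P := fun a => ⁅a, c⁆ ∈ leading K x y 2) hx hy ?_ ?_ ?_ a
    · intro r; simp [lie_algebraMap_left]
    · intro a b ha hb; rw [add_lie]; exact add_mem ha hb
    · intro a b ha hb
      rw [mul_lie]
      exact add_mem (mul_mem_leading a hb) (leading_mul_mem ha b)
  have hx := key x (by simp) (by rw [lie_swap]; exact neg_mem hxy)
  have hy := key y hxy (by simp)
  exact key b (by rw [lie_swap x b]; exact neg_mem (hx b))
    (by rw [lie_swap y b]; exact neg_mem (hy b)) a

include hgen in
-- Moving a coefficient past an element of weight `e` costs weight `e + 1`. Thus coefficients can be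
-- collected on the left, and the Leibniz rule expands brackets with arbitrary entries into brackets
-- with `x` and `y`.
theorem propFil_le_leading (e : ℕ) : propFil K A e ≤ leading K x y e := by
  intro a ha
  rw [mem_propFil] at ha
  induction ha with
  | base a =>
    rw [← mul_one a]
    exact mem_leading_of_proper a (Submodule.subset_span ⟨0, 0, rfl, IsProper.one⟩)
  | zero e => exact zero_mem _
  | add _ _ ha hb => exact add_mem ha hb
  | mul _ _ ha hb => exact leading_mul_leading_mem ha hb
  | comm a b => exact comm_mem_leading hgen a b
  | lie b _ ha => exact lie_mem_leading hgen ha b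
  | mono h _ => exact mem_leading_of_mem h

include hgen in
theorem propFil_le_monoSpan (e : ℕ) :
    propFil K A e ≤ monoSpan x y (properSpace K x y e) ⊔ propFil K A (e + 1) := by
  refine (propFil_le_leading hgen e).trans (Submodule.span_le.2 ?_)
  rintro _ (⟨a, c, hc, rfl⟩ | h)
  · exact mul_mem_monoSpan hgen (properSpace_le_propFil e) a hc
  · exact Submodule.mem_sup_right h

variable (h2 : (2 : K) ≠ 0)

include hgen h2 in
-- A commutator of degree `k ≥ 2` lies in `commIdeal` of index `k - 1 ≥ k / 2`, and indices add
-- under products. So weight `e` guarantees index `⌈e / 2⌉`, and the filtration vanishes in a Lie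
-- nilpotent algebra.
theorem propFil_le_commIdeal {d e : ℕ} (hde : 2 * d ≤ e + 1) : propFil K A e ≤ commIdeal K A d := by
  have anti : Antitone (commIdeal K A) := antitone_nat_of_succ_le commIdeal_succ_le
  suffices h : propFil K A e ≤ commIdeal K A ((e + 1) / 2) from h.trans (anti (by omega))
  clear hde
  intro a ha
  rw [mem_propFil] at ha
  induction ha with
  | base a => exact mem_commIdeal_zero a
  | zero e => exact zero_mem _
  | add _ _ ha hb => exact add_mem ha hb
  | mul _ _ ha hb => exact anti (by omega) (commIdeal_mul_commIdeal_mem hgen h2 ha hb)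
  | comm a b => exact lie_mem_commIdeal_one a b
  | lie b _ ha => exact anti (by omega) (lie_mem_commIdeal hgen h2 ha b)
  | mono h ha => exact anti (by omega) ha

include hgen h2 in
-- Each commutator factor contains both letters, so its degree minus one is at least its degree in
-- either letter. This bounds `a` and `b` in nonzero proper elements.
theorem IsProper.mem_commIdeal {a b : ℕ} {c : A} (h : IsProper K x y a b c) :
    c ∈ commIdeal K A a ∧ c ∈ commIdeal K A b := by
  have anti : Antitone (commIdeal K A) := antitone_nat_of_succ_le commIdeal_succ_le
  induction h with
  | zero a b => exact ⟨zero_mem _, zero_mem _⟩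
  | add _ _ h h' => exact ⟨add_mem h.1 h'.1, add_mem h.2 h'.2⟩
  | smul r _ h => exact ⟨Submodule.smul_mem _ r h.1, Submodule.smul_mem _ r h.2⟩
  | one => exact ⟨mem_commIdeal_zero 1, mem_commIdeal_zero 1⟩
  | comm => exact ⟨lie_mem_commIdeal_one x y, lie_mem_commIdeal_one x y⟩
  | mul _ _ h h' => exact ⟨commIdeal_mul_commIdeal_mem hgen h2 h.1 h'.1,
      commIdeal_mul_commIdeal_mem hgen h2 h.2 h'.2⟩
  | lie_left _ h => exact ⟨lie_mem_commIdeal hgen h2 h.1 x,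
      commIdeal_succ_le _ (lie_mem_commIdeal hgen h2 h.2 x)⟩
  | lie_right _ h => exact ⟨commIdeal_succ_le _ (lie_mem_commIdeal hgen h2 h.1 y),
      lie_mem_commIdeal hgen h2 h.2 y⟩

end Filtration

/-! ### Derivations preserving T-spaces -/

section Derivations

open Polynomial

variable {K A : Type*} [Field K] [Ring A] [Algebra K A]

/-- Evaluation of polynomials over `A` at a scalar. -/
noncomputable def evalScalar (A : Type*) [Ring A] [Algebra K A] (r : K) : A[X] →ₐ[K] A :=
  eval₂AlgHom (AlgHom.id K A) (algebraMap K A r) fun a => (Algebra.commutes r a).symm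

theorem evalScalar_apply (r : K) (p : A[X]) :
    evalScalar A r p = ∑ i ∈ Finset.range (p.natDegree + 1), r ^ i • p.coeff i := by
  have h : evalScalar A r p = eval₂ (RingHom.id A) (algebraMap K A r) p := rfl
  rw [h, eval₂_eq_sum_range]
  refine Finset.sum_congr rfl fun i _ => ?_
  rw [RingHom.id_apply, ← map_pow, ← Algebra.commutes, Algebra.smul_def]

@[simp] theorem evalScalar_C (r : K) (a : A) : evalScalar A r (C a) = a :=
  eval₂_C (RingHom.id A) _

/-- If all the values at scalars of a polynomial with vector coefficients lie in a subspace, then so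
do the coefficients. -/
theorem mem_of_forall_sum_pow_smul_mem [Infinite K] {V : Type*} [AddCommGroup V] [Module K V]
    (W : Submodule K V) (v : ℕ → V) (m : ℕ)
    (h : ∀ r : K, ∑ i ∈ Finset.range m, r ^ i • v i ∈ W) {i : ℕ} (hi : i < m) : v i ∈ W := by
  rw [← Submodule.Quotient.mk_eq_zero W, ← Module.forall_dual_apply_eq_zero_iff K]
  intro l
  -- A linear functional vanishing on `W` reduces the claim to a scalar polynomial that is zero at
  -- every point of an infinite field.
  set P : K[X] := ∑ i ∈ Finset.range m, C (l (Submodule.Quotient.mk (v i))) * X ^ i with hP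
  have hP0 : P = 0 := by
    refine Polynomial.funext fun r => ?_
    have := congrArg l ((Submodule.Quotient.mk_eq_zero W).2 (h r))
    rw [← Submodule.mkQ_apply] at this
    simp only [map_sum, map_smul, smul_eq_mul, map_zero] at this
    simp only [hP, eval_finsetSum, eval_mul, eval_C, eval_pow, eval_X, eval_zero]
    rw [← this]
    exact Finset.sum_congr rfl fun i _ => mul_comm _ _
  have := congrArg (fun p => p.coeff i) hP0
  simpa [hP, finsetSum_coeff, coeff_C_mul, coeff_X_pow, hi] using this

/-- Setting `X` equal to a scalar turns `φ` into an endomorphism of `A`, so all values of `φ w` lie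
in `W`. -/
theorem IsTSpace.coeff_mem [Infinite K] {W : Submodule K A} (hW : IsTSpace W)
    (φ : A →ₐ[K] A[X]) {w : A} (hw : w ∈ W) (i : ℕ) : (φ w).coeff i ∈ W := by
  by_cases hi : i < (φ w).natDegree + 1
  · refine mem_of_forall_sum_pow_smul_mem W (φ w).coeff _ (fun r => ?_) hi
    rw [← evalScalar_apply]
    exact hW ((evalScalar A r).comp φ) w hw
  · rw [coeff_eq_zero_of_natDegree_lt (by omega)]
    exact zero_mem W

/-- A derivation of `A` that leaves every T-space invariant. -/
structure IsTDerivation (δ : A →ₗ[K] A) : Prop where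
  leibniz : ∀ a b, δ (a * b) = a * δ b + δ a * b
  stable : ∀ W : Submodule K A, IsTSpace W → ∀ w ∈ W, δ w ∈ W

namespace IsTDerivation

variable {δ : A →ₗ[K] A} (h : IsTDerivation δ)
include h

theorem map_one : δ 1 = 0 := by
  have := h.leibniz 1 1
  simpa using this

theorem map_algebraMap (r : K) : δ (algebraMap K A r) = 0 := by
  rw [Algebra.algebraMap_eq_smul_one, map_smul, h.map_one, smul_zero]

theorem map_lie (a b : A) : δ ⁅a, b⁆ = ⁅δ a, b⁆ + ⁅a, δ b⁆ := by
  simp only [Ring.lie_def, map_sub, h.leibniz]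
  noncomm_ring

theorem map_pow_of_eq_zero {z : A} (hz : δ z = 0) (i : ℕ) : δ (z ^ i) = 0 := by
  induction i with
  | zero => rw [pow_zero, h.map_one]
  | succ i ih => rw [pow_succ, h.leibniz, hz, ih]; simp

end IsTDerivation

variable {x y : A} (hgen : Algebra.adjoin K {x, y} = ⊤)
  (hU : ∀ f g : A[X], ∃ φ : A →ₐ[K] A[X], φ x = f ∧ φ y = g)

include hgen hU in
-- The derivation is the linear part in `X` of the homomorphism `x ↦ x + f X`, `y ↦ y + g X`.
theorem exists_derivation [Infinite K] (f g : A) :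
    ∃ δ : A →ₗ[K] A, IsTDerivation δ ∧ δ x = f ∧ δ y = g := by
  obtain ⟨φ, hx, hy⟩ := hU (C x + C f * X) (C y + C g * X)
  have h0 : ∀ a, (φ a).coeff 0 = a := by
    refine gen_induction hgen (by simp [hx]) (by simp [hy]) ?_ ?_ ?_
    · intro r; rw [AlgHom.commutes, Polynomial.algebraMap_apply]; simp
    · intro a b ha hb; rw [map_add, coeff_add, ha, hb]
    · intro a b ha hb; rw [map_mul, mul_coeff_zero, ha, hb]
  refine ⟨((lcoeff A 1).restrictScalars K).comp φ.toLinearMap, ⟨?_, ?_⟩, ?_, ?_⟩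
  · intro a b
    change (φ (a * b)).coeff 1 = a * (φ b).coeff 1 + (φ a).coeff 1 * b
    rw [map_mul, mul_coeff_one, h0, h0]
  · intro W hW w hw
    exact hW.coeff_mem φ hw 1
  · change (φ x).coeff 1 = f
    simp [hx]
  · change (φ y).coeff 1 = g
    simp [hy]

/-- `fx` and `fy` act as partial derivatives of `f` for commutation with `f`. -/
def IsPartial (K : Type*) {A : Type*} [Field K] [Ring A] [Algebra K A] (x y f fx fy : A) : Prop :=
  (∀ e, ∀ c ∈ propFil K A e, ⁅c, f⁆ - fx * ⁅c, x⁆ - fy * ⁅c, y⁆ ∈ propFil K A (e + 2)) ∧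
    ∀ c : A, ⁅c, f⁆ - fx * ⁅c, x⁆ - fy * ⁅c, y⁆ ∈ propFil K A 3

theorem isPartial_left : IsPartial K x y x 1 0 := by simp [IsPartial]

theorem isPartial_right : IsPartial K x y y 0 1 := by simp [IsPartial]

theorem IsPartial.mul {f fx fy g gx gy : A} (hf : IsPartial K x y f fx fy)
    (hg : IsPartial K x y g gx gy) :
    IsPartial K x y (f * g) (fx * g + f * gx) (fy * g + f * gy) := by
  have key : ∀ c : A, ⁅c, f * g⁆ - (fx * g + f * gx) * ⁅c, x⁆ - (fy * g + f * gy) * ⁅c, y⁆ =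
      f * (⁅c, g⁆ - gx * ⁅c, x⁆ - gy * ⁅c, y⁆) + (⁅c, f⁆ - fx * ⁅c, x⁆ - fy * ⁅c, y⁆) * g
        + (fx * ⁅⁅c, x⁆, g⁆ + fy * ⁅⁅c, y⁆, g⁆) := by
    intro c
    simp only [Ring.lie_def]; noncomm_ring
  constructor
  · intro e c hc
    rw [key]
    exact add_mem (add_mem (mul_mem_propFil _ (hg.1 e c hc)) (propFil_mul_mem' (hf.1 e c hc) _))
      (add_mem (mul_mem_propFil _ (lie_mem_propFil (lie_mem_propFil hc _) _))
        (mul_mem_propFil _ (lie_mem_propFil (lie_mem_propFil hc _) _)))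
  · intro c
    rw [key]
    exact add_mem (add_mem (mul_mem_propFil _ (hg.2 c)) (propFil_mul_mem' (hf.2 c) _))
      (add_mem (mul_mem_propFil _ (lie_mem_propFil (comm_mem_propFil _ _) _))
        (mul_mem_propFil _ (lie_mem_propFil (comm_mem_propFil _ _) _)))

theorem isPartial_pow_left (v : ℕ) :
    IsPartial K x y (x ^ (v + 1)) (((v + 1 : ℕ) : K) • x ^ v) 0 := by
  induction v with
  | zero => simpa using isPartial_left
  | succ v ih =>
    have h := ih.mul (isPartial_left (K := K) (x := x) (y := y))
    rw [← pow_succ] at h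
    convert h using 1
    · rw [smul_mul_assoc, ← pow_succ, mul_one]; push_cast; module
    · simp

theorem isPartial_pow_right (v : ℕ) :
    IsPartial K x y (y ^ (v + 1)) 0 (((v + 1 : ℕ) : K) • y ^ v) := by
  induction v with
  | zero => simpa using isPartial_right
  | succ v ih =>
    have h := ih.mul (isPartial_right (K := K) (x := x) (y := y))
    rw [← pow_succ] at h
    convert h using 1
    · simp
    · rw [smul_mul_assoc, ← pow_succ, mul_one]; push_cast; module

theorem isPartial_mono (v j : ℕ) :
    IsPartial K x y (x ^ (v + 1) * y ^ (j + 1)) (((v + 1 : ℕ) : K) • (x ^ v * y ^ (j + 1)))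
      (((j + 1 : ℕ) : K) • (x ^ (v + 1) * y ^ j)) := by
  have h := (isPartial_pow_left (K := K) (x := x) (y := y) v).mul (isPartial_pow_right j)
  simpa using h

/-- On proper elements, modulo the next step of the filtration, a derivation acts through its
Jacobian matrix. -/
theorem jacobian_mem {δ E D : A →ₗ[K] A} (hδ : IsTDerivation δ) (hE : IsTDerivation E)
    (hD : IsTDerivation D) {f fx fy : A} (hf : IsPartial K x y f fx fy) (hδx : δ x = f)
    (hδy : δ y = 0) (hEx : E x = x) (hEy : E y = 0) (hDx : D x = y) (hDy : D y = 0)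
    {e : ℕ} {c : A} (hc : c ∈ properSpace K x y e) :
    δ c - fx * E c - fy * D c ∈ propFil K A (e + 1) := by
  induction hc using Submodule.span_induction with
  | zero => simp
  | add b c _ _ hb hc =>
    have h : δ (b + c) - fx * E (b + c) - fy * D (b + c) =
        (δ b - fx * E b - fy * D b) + (δ c - fx * E c - fy * D c) := by
      simp only [map_add]; noncomm_ring
    rw [h]; exact add_mem hb hc
  | smul r b _ hb =>
    have h : δ (r • b) - fx * E (r • b) - fy * D (r • b) =
        r • (δ b - fx * E b - fy * D b) := by
      simp only [map_smul, mul_smul_comm, smul_sub]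
    rw [h]; exact Submodule.smul_mem _ _ hb
  | mem c hc =>
    obtain ⟨a, b, rfl, hc⟩ := hc
    induction hc with
    | zero => simp
    | @add a b c c' _ _ hb hc =>
      have h : δ (c + c') - fx * E (c + c') - fy * D (c + c') =
          (δ c - fx * E c - fy * D c) + (δ c' - fx * E c' - fy * D c') := by
        simp only [map_add]; noncomm_ring
      rw [h]; exact add_mem hb hc
    | @smul a b c r _ hb =>
      have h : δ (r • c) - fx * E (r • c) - fy * D (r • c) =
          r • (δ c - fx * E c - fy * D c) := by
        simp only [map_smul, mul_smul_comm, smul_sub]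
      rw [h]; exact Submodule.smul_mem _ _ hb
    | one => simp [hδ.map_one, hE.map_one, hD.map_one]
    | comm =>
      rw [hδ.map_lie, hE.map_lie, hD.map_lie, hδx, hδy, hEx, hEy, hDx, hDy]
      have h : ⁅f, y⁆ + ⁅x, (0 : A)⁆ - fx * (⁅x, y⁆ + ⁅x, (0 : A)⁆) - fy * (⁅y, y⁆ + ⁅x, (0 : A)⁆)
          = -(⁅y, f⁆ - fx * ⁅y, x⁆ - fy * ⁅y, y⁆) := by
        simp only [Ring.lie_def]; noncomm_ring
      rw [h]
      -- The letter `y` has weight 0, for which the first clause of `IsPartial` would give only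
      -- weight 2; the second clause gives the required 3.
      exact neg_mem (hf.2 y)
    | @mul a b a' b' c c' hc hc' ih ih' =>
      have h : δ (c * c') - fx * E (c * c') - fy * D (c * c') =
          c * (δ c' - fx * E c' - fy * D c') + (δ c - fx * E c - fy * D c) * c'
            + (⁅c, fx⁆ * E c' + ⁅c, fy⁆ * D c') := by
        rw [hδ.leibniz, hE.leibniz, hD.leibniz]
        simp only [Ring.lie_def]; noncomm_ring
      have m := hc.mem_propFil
      have m' := hc'.mem_propFil
      rw [h, show a + a' + (b + b') + 1 = (a + b) + (a' + b' + 1) by omega]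
      refine add_mem (add_mem (propFil_mul_mem m ih') ?_) (add_mem ?_ ?_)
      · rw [show (a + b) + (a' + b' + 1) = (a + b + 1) + (a' + b') by omega]
        exact propFil_mul_mem ih m'
      · rw [show (a + b) + (a' + b' + 1) = (a + b + 1) + (a' + b') by omega]
        exact propFil_mul_mem (lie_mem_propFil m _) (hE.stable _ (isTSpace_propFil _) _ m')
      · rw [show (a + b) + (a' + b' + 1) = (a + b + 1) + (a' + b') by omega]
        exact propFil_mul_mem (lie_mem_propFil m _) (hD.stable _ (isTSpace_propFil _) _ m')
    | @lie_left a b c hc ih =>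
      have h : δ ⁅c, x⁆ - fx * E ⁅c, x⁆ - fy * D ⁅c, x⁆ =
          ⁅δ c - fx * E c - fy * D c, x⁆ + (⁅c, f⁆ - fx * ⁅c, x⁆ - fy * ⁅c, y⁆)
            + (⁅fx, x⁆ * E c + ⁅fy, x⁆ * D c) := by
        rw [hδ.map_lie, hE.map_lie, hD.map_lie, hδx, hEx, hDx]
        simp only [Ring.lie_def]; noncomm_ring
      have m := hc.mem_propFil
      rw [h, show a + 1 + b + 1 = a + b + 2 by omega]
      refine add_mem (add_mem (lie_mem_propFil ih x) (hf.1 _ c m)) (add_mem ?_ ?_)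
      · rw [add_comm]
        exact propFil_mul_mem (comm_mem_propFil _ _) (hE.stable _ (isTSpace_propFil _) _ m)
      · rw [add_comm]
        exact propFil_mul_mem (comm_mem_propFil _ _) (hD.stable _ (isTSpace_propFil _) _ m)
    | @lie_right a b c hc ih =>
      have h : δ ⁅c, y⁆ - fx * E ⁅c, y⁆ - fy * D ⁅c, y⁆ =
          ⁅δ c - fx * E c - fy * D c, y⁆ + (⁅fx, y⁆ * E c + ⁅fy, y⁆ * D c) := by
        rw [hδ.map_lie, hE.map_lie, hD.map_lie, hδy, hEy, hDy]
        simp only [Ring.lie_def]; noncomm_ring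
      have m := hc.mem_propFil
      rw [h, show a + (b + 1) + 1 = a + b + 2 by omega]
      refine add_mem (lie_mem_propFil ih y) (add_mem ?_ ?_)
      · rw [add_comm]
        exact propFil_mul_mem (comm_mem_propFil _ _) (hE.stable _ (isTSpace_propFil _) _ m)
      · rw [add_comm]
        exact propFil_mul_mem (comm_mem_propFil _ _) (hD.stable _ (isTSpace_propFil _) _ m)

theorem IsProper.euler {E : A →ₗ[K] A} (hE : IsTDerivation E) (hEx : E x = x) (hEy : E y = 0)
    {a b : ℕ} {c : A} (hc : IsProper K x y a b c) : E c = (a : K) • c := by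
  induction hc with
  | zero => simp
  | add _ _ h h' => rw [map_add, h, h', smul_add]
  | smul r _ h => rw [map_smul, h, smul_comm]
  | one => simp [hE.map_one]
  | comm => rw [hE.map_lie, hEx, hEy]; simp
  | mul _ _ h h' =>
    rw [hE.leibniz, h, h', mul_smul_comm, smul_mul_assoc]; push_cast; module
  | lie_left _ h => rw [hE.map_lie, hEx, h, smul_lie]; push_cast; module
  | lie_right _ h => rw [hE.map_lie, hEy, h, smul_lie]; simp

/-- Commutators do not notice central changes of the letters. It is applied to the formal partial
derivatives `x ↦ 1` and `y ↦ 1`. -/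
theorem IsProper.map_eq_zero {δ : A →ₗ[K] A} (hδ : IsTDerivation δ) (hx : ∀ z : A, ⁅z, δ x⁆ = 0)
    (hy : ∀ z : A, ⁅z, δ y⁆ = 0) {a b : ℕ} {c : A} (hc : IsProper K x y a b c) : δ c = 0 := by
  induction hc with
  | zero => simp
  | add _ _ h h' => rw [map_add, h, h', add_zero]
  | smul r _ h => rw [map_smul, h, smul_zero]
  | one => exact hδ.map_one
  | comm => rw [hδ.map_lie, hy, lie_swap, hx]; simp
  | mul _ _ h h' => rw [hδ.leibniz, h, h']; simp
  | lie_left _ h => rw [hδ.map_lie, h, hx]; simp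
  | lie_right _ h => rw [hδ.map_lie, h, hy]; simp

theorem IsProper.map_mem_properSpace {D : A →ₗ[K] A} (hD : IsTDerivation D) (hDx : D x = y)
    (hDy : D y = 0) {a b : ℕ} {c : A} (hc : IsProper K x y a b c) :
    D c ∈ properSpace K x y (a + b) := by
  have mem : ∀ {a b : ℕ} {c : A}, IsProper K x y a b c → c ∈ properSpace K x y (a + b) :=
    fun h => Submodule.subset_span ⟨_, _, rfl, h⟩
  induction hc with
  | zero => simp
  | add _ _ h h' => rw [map_add]; exact add_mem h h'
  | smul r _ h => rw [map_smul]; exact Submodule.smul_mem _ _ h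
  | one => simp [hD.map_one]
  | comm => rw [hD.map_lie, hDx, hDy]; simp
  | mul hc hc' h h' =>
    rw [hD.leibniz, add_add_add_comm]
    exact add_mem (properSpace_mul_mem (mem hc) h') (properSpace_mul_mem h (mem hc'))
  | lie_left hc h =>
    rw [hD.map_lie, hDx, add_right_comm]
    exact add_mem (lie_left_mem_properSpace h) (lie_right_mem_properSpace (mem hc))
  | lie_right hc h =>
    rw [hD.map_lie, hDy, lie_zero, add_zero]
    exact lie_right_mem_properSpace h

include hgen in
-- `D` replaces one `x` by `y`, so it lowers the `E`-eigenvalue by one.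
theorem euler_comp {E D : A →ₗ[K] A} (hE : IsTDerivation E)
    (hD : IsTDerivation D) (hEx : E x = x) (hEy : E y = 0) (hDx : D x = y) (hDy : D y = 0) (z : A) :
    E (D z) = D (E z) - D z := by
  refine gen_induction hgen (P := fun z => E (D z) = D (E z) - D z) ?_ ?_ ?_ ?_ ?_ z
  · simp [hEx, hEy, hDx]
  · simp [hEy, hDy]
  · intro r; simp [hE.map_algebraMap, hD.map_algebraMap]
  · intro a b ha hb
    simp only [map_add, ha, hb]; noncomm_ring
  · intro a b ha hb
    simp only [hE.leibniz, hD.leibniz, map_add, ha, hb]; noncomm_ring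

end Derivations

/-! ### T-spaces between consecutive terms of the filtration -/

section Simplicity

open Polynomial

variable {K A : Type*} [Field K] [Ring A] [Algebra K A] {x y : A}

theorem IsProper.mem_properSpace {a b : ℕ} {c : A} (hc : IsProper K x y a b c) :
    c ∈ properSpace K x y (a + b) :=
  Submodule.subset_span ⟨a, b, rfl, hc⟩

theorem map_pow_left {δ : A →ₗ[K] A} (hδ : IsTDerivation δ) (hδx : δ x = x * x) (v : ℕ) :
    δ (x ^ v) = (v : K) • x ^ (v + 1) := by
  induction v with
  | zero => simp [hδ.map_one]
  | succ v ih =>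
    rw [pow_succ, hδ.leibniz, ih, hδx, smul_mul_assoc, ← mul_assoc, ← pow_succ, ← pow_succ]
    push_cast; module

/-- The action of the derivation `x ↦ x ^ 2`, `y ↦ 0` on monomial multiples of proper elements. -/
theorem sq_derivation_mono {δ E D : A →ₗ[K] A} (hδ : IsTDerivation δ) (hE : IsTDerivation E)
    (hD : IsTDerivation D) (hδx : δ x = x * x) (hδy : δ y = 0) (hEx : E x = x) (hEy : E y = 0)
    (hDx : D x = y) (hDy : D y = 0) {e : ℕ} {c : A} (hc : c ∈ properSpace K x y e) {r : K}
    (hr : E c = r • c) (v j : ℕ) :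
    δ (x ^ v * y ^ j * c) - ((v : K) + 2 * r) • (x ^ (v + 1) * y ^ j * c) ∈
      propFil K A (e + 1) := by
  have hp := (isPartial_left (K := K) (x := x) (y := y)).mul isPartial_left
  have hj := jacobian_mem hδ hE hD hp hδx hδy hEx hEy hDx hDy hc
  have h1 : δ (x ^ v * y ^ j * c) - ((v : K) + 2 * r) • (x ^ (v + 1) * y ^ j * c) =
      x ^ v * y ^ j * (δ c - (1 * x + x * 1) * E c - (0 * x + x * 0) * D c)
        + (2 * r) • (x ^ v * ⁅y ^ j, x⁆ * c) := by
    rw [hδ.leibniz, hδ.leibniz, map_pow_left hδ hδx, hδ.map_pow_of_eq_zero hδy, hr, Ring.lie_def]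
    simp only [one_mul, mul_one, zero_mul, mul_zero, sub_zero, add_zero, zero_add, mul_sub, sub_mul,
      add_mul, mul_add, mul_smul_comm, smul_mul_assoc, mul_assoc, pow_succ]
    module
  rw [h1]
  refine add_mem (mul_mem_propFil _ hj) (Submodule.smul_mem _ _ ?_)
  refine propFil_antitone (show e + 1 ≤ 2 + e by omega) ?_
  exact propFil_mul_mem (mul_mem_propFil _ (comm_mem_propFil _ _)) (properSpace_le_propFil e hc)

variable (hgen : Algebra.adjoin K {x, y} = ⊤)
  (hU : ∀ f g : A[X], ∃ φ : A →ₐ[K] A[X], φ x = f ∧ φ y = g)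

include hgen hU in
-- A single derivation applied to `c` yields only a mixture of multiples of `c` and `D c`. Since
-- these have different `x`-degrees, the derivation `x ↦ x²` separates them.
theorem mono_mul_mem_of_left [Infinite K] (h2 : (2 : K) ≠ 0) {W : Submodule K A} (hW : IsTSpace W)
    {a b : ℕ} {c : A} (hc : IsProper K x y a b c) (hcW : c ∈ W)
    (hle : propFil K A (a + b + 1) ≤ W) (ha : (a : K) ≠ 0) (ha1 : (a : K) ≠ 1) (i j : ℕ) :
    x ^ i * y ^ j * c ∈ W := by
  obtain ⟨E, hE, hEx, hEy⟩ := exists_derivation hgen hU x 0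
  obtain ⟨D, hD, hDx, hDy⟩ := exists_derivation hgen hU y 0
  obtain ⟨δ, hδ, hδx, hδy⟩ := exists_derivation hgen hU (x * x) 0
  have hcE := hc.euler hE hEx hEy
  have hDcE : E (D c) = ((a : K) - 1) • D c := by
    rw [euler_comp hgen hE hD hEx hEy hDx hDy, hcE, map_smul]; module
  have hcP := hc.mem_properSpace
  have hDcP := hc.map_mem_properSpace hD hDx hDy
  -- This is the Jacobian of `x ↦ x ^ (v + 1) * y ^ (j + 1)`, with `E c = a • c`.
  have hu : ∀ v j : ℕ, ((a : K) * (v + 1)) • (x ^ v * y ^ (j + 1) * c)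
      + ((j : K) + 1) • (x ^ (v + 1) * y ^ j * D c) ∈ W := by
    intro v j
    obtain ⟨δ', hδ', hδx', hδy'⟩ := exists_derivation hgen hU (x ^ (v + 1) * y ^ (j + 1)) 0
    have h := hle (jacobian_mem hδ' hE hD (isPartial_mono v j) hδx' hδy' hEx hEy hDx hDy hcP)
    have h' := sub_mem (hδ'.stable W hW c hcW) h
    rw [hcE] at h'
    convert h' using 1
    simp only [smul_mul_assoc, mul_smul_comm]
    push_cast
    module
  have hm : ∀ v j : ℕ, x ^ (v + 1) * y ^ (j + 1) * c ∈ W := by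
    intro v j
    have h1 := hδ.stable W hW _ (hu v j)
    have hA := hle (sq_derivation_mono hδ hE hD hδx hδy hEx hEy hDx hDy hcP hcE v (j + 1))
    have hB := hle (sq_derivation_mono hδ hE hD hδx hδy hEx hEy hDx hDy hDcP hDcE (v + 1) j)
    have h3 := hu (v + 1) j
    -- Subtracting `v + 2a - 1` times the relation `hu (v + 1) j` cancels the `D c` terms. What
    -- remains is `a((v + 1)(v + 2a) - (v + 2)(v + 2a - 1)) = a(2 - 2a)`.
    have h4 : ((a : K) * (2 - 2 * a)) • (x ^ (v + 1) * y ^ (j + 1) * c) ∈ W := by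
      have h5 := sub_mem (sub_mem (sub_mem h1 (W.smul_mem ((a : K) * (v + 1)) hA))
        (W.smul_mem ((j : K) + 1) hB)) (W.smul_mem ((v : K) + 2 * a - 1) h3)
      convert h5 using 1
      simp only [map_add, map_smul]
      push_cast
      module
    refine (W.smul_mem_iff (mul_ne_zero ha ?_)).1 h4
    rw [show (2 : K) - 2 * a = 2 * (1 - a) by ring]
    exact mul_ne_zero h2 (sub_ne_zero.2 ha1.symm)
  -- Exponent zero is reached by a partial derivative, which kills `c` and sends `x` to 1; below,
  -- `y` is treated in the same way.
  have hm' : ∀ i j : ℕ, x ^ i * y ^ (j + 1) * c ∈ W := by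
    intro i j
    rcases i with _ | i
    · obtain ⟨d, hd, hdx, hdy⟩ := exists_derivation hgen hU 1 0
      have hdc : d c = 0 := hc.map_eq_zero hd (by simp [hdx, Ring.lie_def]) (by simp [hdy])
      have h := hd.stable W hW _ (hm 0 j)
      rwa [hd.leibniz, hd.leibniz, hdc, zero_add, pow_one, hdx, hd.map_pow_of_eq_zero hdy, mul_zero,
        mul_zero, zero_add, zero_add, ← pow_zero x] at h
    · exact hm i j
  rcases j with _ | j
  · obtain ⟨d, hd, hdx, hdy⟩ := exists_derivation hgen hU 0 1
    have hdc : d c = 0 := hc.map_eq_zero hd (by simp [hdx]) (by simp [hdy, Ring.lie_def])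
    have h := hd.stable W hW _ (hm' i 0)
    rwa [hd.leibniz, hd.leibniz, hdc, zero_add, pow_one, hdy, hd.map_pow_of_eq_zero hdx, mul_zero,
      zero_add, zero_mul, add_zero, ← pow_zero y] at h
  · exact hm' i j

include hgen hU in
theorem exists_swap : ∃ σ : A →ₐ[K] A, σ x = y ∧ σ y = x ∧ ∀ a, σ (σ a) = a := by
  -- The universal property has target `A[X]`; evaluation at 0 brings the map back to `A`.
  obtain ⟨φ, hx, hy⟩ := hU (C y) (C x)
  have hσx : (evalScalar A (0 : K)).comp φ x = y := by simp [hx]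
  have hσy : (evalScalar A (0 : K)).comp φ y = x := by simp [hy]
  refine ⟨(evalScalar A (0 : K)).comp φ, hσx, hσy, ?_⟩
  generalize (evalScalar A (0 : K)).comp φ = σ at hσx hσy
  refine gen_induction hgen (by rw [hσx, hσy]) (by rw [hσy, hσx]) ?_ ?_ ?_
  · intro r; simp
  · intro a b ha hb; rw [map_add, map_add, ha, hb]
  · intro a b ha hb; rw [map_mul, map_mul, ha, hb]

theorem IsProper.swap {σ : A →ₐ[K] A} (hx : σ x = y) (hy : σ y = x) {a b : ℕ} {c : A}
    (hc : IsProper K x y a b c) : IsProper K x y b a (σ c) := by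
  induction hc with
  | zero => rw [map_zero]; exact IsProper.zero _ _
  | add _ _ h h' => rw [map_add]; exact h.add h'
  | smul r _ h => rw [map_smul]; exact h.smul r
  | one => rw [map_one]; exact IsProper.one
  | comm =>
    rw [map_lie, hx, hy, lie_swap, ← neg_one_smul K]
    exact IsProper.comm.smul _
  | mul _ _ h h' => rw [map_mul]; exact h.mul h'
  | lie_left _ h => rw [map_lie, hx]; exact h.lie_right
  | lie_right _ h => rw [map_lie, hy]; exact h.lie_left

include hgen hU in
-- The left case is carried over by exchanging the letters. Restoring the order of the monomial
-- costs a commutator, hence weight.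
theorem mono_mul_mem_of_right [Infinite K] (h2 : (2 : K) ≠ 0) {W : Submodule K A} (hW : IsTSpace W)
    {a b : ℕ} {c : A} (hc : IsProper K x y a b c) (hcW : c ∈ W)
    (hle : propFil K A (a + b + 1) ≤ W) (hb : (b : K) ≠ 0) (hb1 : (b : K) ≠ 1) (i j : ℕ) :
    x ^ i * y ^ j * c ∈ W := by
  obtain ⟨σ, hx, hy, hσ⟩ := exists_swap hgen hU
  have h := hW σ _ (mono_mul_mem_of_left hgen hU h2 hW (hc.swap hx hy) (hW σ c hcW)
    (by rwa [add_comm b a]) hb hb1 j i)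
  rw [map_mul, map_mul, map_pow, map_pow, hx, hy, hσ] at h
  have e : x ^ i * y ^ j * c = y ^ j * x ^ i * c + ⁅x ^ i, y ^ j⁆ * c := by
    simp only [Ring.lie_def]; noncomm_ring
  rw [e]
  refine add_mem h (hle (propFil_antitone (show a + b + 1 ≤ 2 + (a + b) by omega) ?_))
  exact propFil_mul_mem (comm_mem_propFil _ _) hc.mem_propFil

include hU in
-- The scaling `x ↦ x X` multiplies bidegree `(a, b)` by `X ^ a`, so the bihomogeneous components of
-- `c` are coefficients and remain in `W`.
theorem mem_span_proper_inf [Infinite K] {W : Submodule K A} (hW : IsTSpace W) {e : ℕ} {c : A}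
    (hc : c ∈ properSpace K x y e) (hcW : c ∈ W) :
    c ∈ Submodule.span K {c | ∃ a b, a + b = e ∧ IsProper K x y a b c ∧ c ∈ W} := by
  obtain ⟨φ, hx, hy⟩ := hU (C x * X) (C y)
  have hφ : ∀ {a b : ℕ} {c : A}, IsProper K x y a b c → φ c = C c * X ^ a := by
    intro a b c hc
    induction hc with
    | zero => simp
    | add _ _ h h' => rw [map_add, h, h', C_add, add_mul]
    | smul r _ h => rw [map_smul, h, ← smul_C, smul_mul_assoc]
    | one => simp
    | comm =>
      rw [map_lie, hx, hy, Ring.lie_def, mul_assoc, X_mul_C, pow_one, Ring.lie_def]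
      simp [sub_mul, mul_assoc]
    | mul _ _ h h' =>
      rw [map_mul, h, h', pow_add, C_mul, mul_assoc, ← mul_assoc (X ^ _), X_pow_mul_C]
      simp only [mul_assoc]
    | @lie_left a b c _ h =>
      have e1 : C c * X ^ a * (C x * X) = C c * C x * X ^ (a + 1) := by
        rw [mul_assoc, ← mul_assoc (X ^ a), X_pow_mul_C, mul_assoc, ← pow_succ, ← mul_assoc]
      have e2 : C x * X * (C c * X ^ a) = C x * C c * X ^ (a + 1) := by
        rw [mul_assoc, ← mul_assoc X, X_mul_C, mul_assoc, ← pow_succ', ← mul_assoc]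
      rw [map_lie, h, hx, Ring.lie_def, Ring.lie_def, e1, e2, C_sub, C_mul, C_mul, sub_mul]
    | lie_right _ h =>
      rw [map_lie, h, hy, Ring.lie_def, Ring.lie_def, mul_assoc, X_pow_mul_C]
      simp only [C_sub, C_mul, sub_mul, mul_assoc]
  have key : (∀ a ≤ e, IsProper K x y a (e - a) ((φ c).coeff a)) ∧
      c = ∑ a ∈ Finset.range (e + 1), (φ c).coeff a := by
    clear hcW
    induction hc using Submodule.span_induction with
    | mem c hc =>
      obtain ⟨a, b, rfl, hc⟩ := hc
      rw [hφ hc]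
      simp only [coeff_C_mul, coeff_X_pow]
      constructor
      · intro a' _
        split_ifs with h
        · subst h; simpa using hc
        · simpa using IsProper.zero _ _
      · simp
    | zero => exact ⟨fun a _ => by simpa using IsProper.zero _ _, by simp⟩
    | add b c _ _ hb hc =>
      simp only [map_add, coeff_add]
      refine ⟨fun a ha => (hb.1 a ha).add (hc.1 a ha), ?_⟩
      rw [Finset.sum_add_distrib, ← hb.2, ← hc.2]
    | smul r b _ hb =>
      simp only [map_smul, coeff_smul]
      refine ⟨fun a ha => (hb.1 a ha).smul r, ?_⟩
      rw [← Finset.smul_sum, ← hb.2]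
  rw [key.2]
  refine sum_mem fun a ha => Submodule.subset_span ⟨a, e - a, ?_, ?_, hW.coeff_mem φ hcW a⟩
  · have := Finset.mem_range.1 ha; omega
  · exact key.1 a (by have := Finset.mem_range.1 ha; omega)

/-- The span of the elements `z ^ i * u` with `i < m` and `u ∈ U`. -/
def powSpan {K A : Type*} [Field K] [Ring A] [Algebra K A] (z : A) (U : Submodule K A) (m : ℕ) :
    Submodule K A :=
  Submodule.span K {w | ∃ i < m, ∃ u ∈ U, w = z ^ i * u}

/-- The span of the elements `z ^ i * u` with `u ∈ U`. -/
def powSpanTop {K A : Type*} [Field K] [Ring A] [Algebra K A] (z : A) (U : Submodule K A) :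
    Submodule K A :=
  Submodule.span K {w | ∃ i : ℕ, ∃ u ∈ U, w = z ^ i * u}

theorem powSpan_mono (z : A) (U : Submodule K A) : Monotone (powSpan z U) := by
  intro m n hmn
  refine Submodule.span_mono ?_
  rintro _ ⟨i, hi, u, hu, rfl⟩
  exact ⟨i, hi.trans_le hmn, u, hu, rfl⟩

theorem exists_mem_powSpan {z : A} {U : Submodule K A} {w : A} (hw : w ∈ powSpanTop z U) :
    ∃ m, w ∈ powSpan z U m := by
  induction hw using Submodule.span_induction with
  | mem w hw =>
    obtain ⟨i, u, hu, rfl⟩ := hw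
    exact ⟨i + 1, Submodule.subset_span ⟨i, by omega, u, hu, rfl⟩⟩
  | zero => exact ⟨0, zero_mem _⟩
  | add b c _ _ hb hc =>
    obtain ⟨m, hm⟩ := hb
    obtain ⟨n, hn⟩ := hc
    exact ⟨max m n, add_mem (powSpan_mono z U (le_max_left m n) hm)
      (powSpan_mono z U (le_max_right m n) hn)⟩
  | smul r b _ hb =>
    obtain ⟨m, hm⟩ := hb
    exact ⟨m, Submodule.smul_mem _ _ hm⟩

theorem exists_of_mem_powSpan_succ {z : A} {U : Submodule K A} {w : A} {m : ℕ}
    (hw : w ∈ powSpan z U (m + 1)) : ∃ r ∈ powSpan z U m, ∃ u ∈ U, w = r + z ^ m * u := by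
  induction hw using Submodule.span_induction with
  | mem w hw =>
    obtain ⟨i, hi, u, hu, rfl⟩ := hw
    rcases Nat.lt_succ_iff_lt_or_eq.1 hi with h | rfl
    · exact ⟨_, Submodule.subset_span ⟨i, h, u, hu, rfl⟩, 0, zero_mem _, by simp⟩
    · exact ⟨0, zero_mem _, u, hu, by simp⟩
  | zero => exact ⟨0, zero_mem _, 0, zero_mem _, by simp⟩
  | add b c _ _ hb hc =>
    obtain ⟨r, hr, u, hu, rfl⟩ := hb
    obtain ⟨r', hr', u', hu', rfl⟩ := hc
    exact ⟨r + r', add_mem hr hr', u + u', add_mem hu hu', by noncomm_ring⟩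
  | smul s b _ hb =>
    obtain ⟨r, hr, u, hu, rfl⟩ := hb
    exact ⟨s • r, Submodule.smul_mem _ _ hr, s • u, Submodule.smul_mem _ _ hu, by
      rw [smul_add, mul_smul_comm]⟩

/-- The translation `z ↦ z + X` fixes `U`, so the coefficient of `X ^ m` in the image of `r + z ^ m
* u` is `u`. Hence `u ∈ W`, the term `z ^ m * u` can be subtracted, and `m` drops. -/
theorem inf_powSpanTop_le [Infinite K] {z : A} {U W : Submodule K A} (hW : IsTSpace W)
    (φ : A →ₐ[K] A[X]) (hz : φ z = X + C z) (hU : ∀ u ∈ U, φ u = C u)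
    (hmul : ∀ u ∈ U ⊓ W, ∀ i, z ^ i * u ∈ W) : W ⊓ powSpanTop z U ≤ powSpanTop z (U ⊓ W) := by
  rintro w ⟨hw, hw'⟩
  obtain ⟨m, hm⟩ := exists_mem_powSpan hw'
  clear hw'
  induction m generalizing w with
  | zero =>
    have : w ∈ (⊥ : Submodule K A) := by simpa [powSpan] using hm
    rw [(Submodule.mem_bot K).1 this]
    exact zero_mem _
  | succ m ih =>
    obtain ⟨r, hr, u, hu, rfl⟩ := exists_of_mem_powSpan_succ hm
    have hr0 : (φ r).coeff m = 0 := by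
      clear hw hm
      induction hr using Submodule.span_induction with
      | mem r hr =>
        obtain ⟨i, hi, u, hu, rfl⟩ := hr
        rw [map_mul, map_pow, hz, hU u hu, coeff_mul_C, coeff_X_add_C_pow,
          Nat.choose_eq_zero_of_lt hi]
        simp
      | zero => simp
      | add b c _ _ hb hc => rw [map_add, coeff_add, hb, hc, add_zero]
      | smul s b _ hb => rw [map_smul, coeff_smul, hb, smul_zero]
    have huW : u ∈ W := by
      have h := hW.coeff_mem φ hw m
      rw [map_add, coeff_add, hr0, map_mul, map_pow, hz, hU u hu, coeff_mul_C,
        coeff_X_add_C_pow] at h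
      simpa using h
    have hzu := hmul u ⟨hu, huW⟩ m
    refine add_mem (ih ?_ hr) (Submodule.subset_span ⟨m, u, ⟨hu, huW⟩, rfl⟩)
    have := sub_mem hw hzu
    rwa [add_sub_cancel_right] at this

theorem IsProper.map_eq_C {φ : A →ₐ[K] A[X]} {p q : A[X]} (hx : φ x = p + C x) (hy : φ y = q + C y)
    (hp : ∀ f, p * f = f * p) (hq : ∀ f, q * f = f * q) {a b : ℕ} {c : A}
    (hc : IsProper K x y a b c) : φ c = C c := by
  induction hc with
  | zero => simp
  | add _ _ h h' => rw [map_add, h, h', C_add]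
  | smul r _ h => rw [map_smul, h, smul_C]
  | one => simp
  | comm =>
    have e : ⁅p + C x, q + C y⁆ = (p * q - q * p) + (p * C y - C y * p) - (q * C x - C x * q)
        + (C x * C y - C y * C x) := by
      simp only [Ring.lie_def]; noncomm_ring
    rw [map_lie, hx, hy, e, hp q, hp, hq (C x), Ring.lie_def, C_sub, C_mul, C_mul]
    simp
  | mul _ _ h h' => rw [map_mul, h, h', C_mul]
  | @lie_left a b c _ h =>
    have e : ⁅C c, p + C x⁆ = (C c * p - p * C c) + (C c * C x - C x * C c) := by
      simp only [Ring.lie_def]; noncomm_ring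
    rw [map_lie, hx, h, e, hp, Ring.lie_def, C_sub, C_mul, C_mul]
    simp
  | @lie_right a b c _ h =>
    have e : ⁅C c, q + C y⁆ = (C c * q - q * C c) + (C c * C y - C y * C c) := by
      simp only [Ring.lie_def]; noncomm_ring
    rw [map_lie, hy, h, e, hq, Ring.lie_def, C_sub, C_mul, C_mul]
    simp

theorem map_eq_C_of_mem_properSpace {φ : A →ₐ[K] A[X]} {p q : A[X]} (hx : φ x = p + C x)
    (hy : φ y = q + C y) (hp : ∀ f, p * f = f * p) (hq : ∀ f, q * f = f * q) {e : ℕ} {c : A}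
    (hc : c ∈ properSpace K x y e) : φ c = C c := by
  induction hc using Submodule.span_induction with
  | mem c hc =>
    obtain ⟨a, b, _, hc⟩ := hc
    exact hc.map_eq_C hx hy hp hq
  | zero => simp
  | add b c _ _ hb hc => rw [map_add, hb, hc, C_add]
  | smul r b _ hb => rw [map_smul, hb, smul_C]

include hgen hU in
/-- A T-space between two consecutive members of the filtration is spanned, modulo the smaller
member, by the monomial multiples of its proper elements. -/
theorem tSpace_le_monoSpan [Infinite K] {W : Submodule K A} (hW : IsTSpace W) {e : ℕ}
    (hle : propFil K A (e + 1) ≤ W) (hge : W ≤ propFil K A e)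
    (hmono : ∀ c ∈ properSpace K x y e ⊓ W, ∀ i j, x ^ i * y ^ j * c ∈ W) :
    W ≤ monoSpan x y (properSpace K x y e ⊓ W) ⊔ propFil K A (e + 1) := by
  -- `ψ` moves only `y` and strips powers of `y` off proper elements. `φ` moves only `x`, so it also
  -- fixes `powSpanTop y S` and strips powers of `x` there.
  obtain ⟨φ, hφx, hφy⟩ := hU (X + C x) (0 + C y)
  obtain ⟨ψ, hψx, hψy⟩ := hU (0 + C x) (X + C y)
  set S := properSpace K x y e with hS
  have hX : ∀ f : A[X], X * f = f * X := fun f => X_mul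
  have h0 : ∀ f : A[X], 0 * f = f * 0 := by simp
  have hψ := inf_powSpanTop_le hW ψ hψy
    (fun u hu => map_eq_C_of_mem_properSpace hψx hψy h0 hX (e := e) hu)
    (fun u hu j => by simpa using hmono u hu 0 j)
  have hφ : ∀ u ∈ powSpanTop y S, φ u = C u := by
    intro u hu
    induction hu using Submodule.span_induction with
    | mem u hu =>
      obtain ⟨j, c, hc, rfl⟩ := hu
      rw [map_mul, map_pow, hφy, map_eq_C_of_mem_properSpace hφx hφy hX h0 hc, zero_add, C_mul,
        C_pow]
    | zero => simp
    | add b c _ _ hb hc => rw [map_add, hb, hc, C_add]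
    | smul r b _ hb => rw [map_smul, hb, smul_C]
  have hsub : powSpanTop y S ⊓ W ≤ powSpanTop y (S ⊓ W) := by rwa [inf_comm]
  have hmulx : ∀ u ∈ powSpanTop y S ⊓ W, ∀ i, x ^ i * u ∈ W ∧
      x ^ i * u ∈ monoSpan x y (S ⊓ W) := by
    intro u hu i
    have hu' := hsub hu
    clear hu
    induction hu' using Submodule.span_induction with
    | mem u hu =>
      obtain ⟨j, c, hc, rfl⟩ := hu
      rw [← mul_assoc]
      exact ⟨hmono c hc i j, Submodule.subset_span ⟨i, j, c, hc, rfl⟩⟩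
    | zero => simp
    | add b c _ _ hb hc => rw [mul_add]; exact ⟨add_mem hb.1 hc.1, add_mem hb.2 hc.2⟩
    | smul r b _ hb =>
      rw [mul_smul_comm]; exact ⟨W.smul_mem r hb.1, Submodule.smul_mem _ r hb.2⟩
  intro w hw
  obtain ⟨m, hm, h, hh, rfl⟩ := Submodule.mem_sup.1 (propFil_le_monoSpan hgen e (hge hw))
  refine Submodule.add_mem_sup ?_ hh
  have hmW : m ∈ W := by
    have := sub_mem hw (hle hh)
    rwa [add_sub_cancel_right] at this
  have hmS : m ∈ powSpanTop x (powSpanTop y S) := by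
    refine Submodule.span_le.2 ?_ hm
    rintro _ ⟨i, j, c, hc, rfl⟩
    rw [mul_assoc]
    exact Submodule.subset_span ⟨i, _, Submodule.subset_span ⟨j, c, hc, rfl⟩, rfl⟩
  have hmem := inf_powSpanTop_le hW φ hφx hφ (fun u hu i => (hmulx u hu i).1) ⟨hmW, hmS⟩
  refine Submodule.span_le.2 ?_ hmem
  rintro _ ⟨i, u, hu, rfl⟩
  exact (hmulx u hu i).2

include hgen in
-- Modulo the next term, left multiplication only changes the monomial coefficients, and right
-- multiplication agrees with left multiplication.
theorem isIdeal_of_le_monoSpan {W : Submodule K A} {e : ℕ} (hle : propFil K A (e + 1) ≤ W)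
    (hge : W ≤ propFil K A e)
    (hmono : ∀ c ∈ properSpace K x y e ⊓ W, ∀ i j, x ^ i * y ^ j * c ∈ W)
    (hspan : W ≤ monoSpan x y (properSpace K x y e ⊓ W) ⊔ propFil K A (e + 1)) : IsIdeal W := by
  have hsup : monoSpan x y (properSpace K x y e ⊓ W) ⊔ propFil K A (e + 1) ≤ W := by
    refine sup_le (Submodule.span_le.2 ?_) hle
    rintro _ ⟨i, j, c, hc, rfl⟩
    exact hmono c hc i j
  have hleft : ∀ a : A, ∀ w ∈ W, a * w ∈ W := by
    intro a w hw
    obtain ⟨m, hm, h, hh, rfl⟩ := Submodule.mem_sup.1 (hspan hw)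
    rw [mul_add]
    refine add_mem ?_ (hle (mul_mem_propFil a hh))
    clear hw
    induction hm using Submodule.span_induction with
    | mem m hm =>
      obtain ⟨i, j, c, hc, rfl⟩ := hm
      rw [← mul_assoc]
      exact hsup (mul_mem_monoSpan hgen (inf_le_right.trans hge) _ hc)
    | zero => simp
    | add b c _ _ hb hc => rw [mul_add]; exact add_mem hb hc
    | smul r b _ hb => rw [mul_smul_comm]; exact W.smul_mem r hb
  intro a w hw
  refine ⟨hleft a w hw, ?_⟩
  have h : w * a = a * w + ⁅w, a⁆ := by simp only [Ring.lie_def]; noncomm_ring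
  rw [h]
  exact add_mem (hleft a w hw) (hle (lie_mem_propFil (hge hw) a))

include hgen hU in
/-- In a Lie nilpotent algebra of class less than `n`, monomial multiples of proper elements of
degree at least three stay in a T-space containing the next step of the filtration. -/
theorem mono_mul_mem [Infinite K] {n : ℕ} (hn : 4 ≤ n) (hnil : commIdeal K A (n - 1) = ⊥)
    (hchar : ∀ m : ℕ, 0 < m → m < n → (m : K) ≠ 0) {W : Submodule K A} (hW : IsTSpace W) {e : ℕ}
    (he : 3 ≤ e) (hle : propFil K A (e + 1) ≤ W) {c : A} (hc : c ∈ properSpace K x y e ⊓ W)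
    (i j : ℕ) : x ^ i * y ^ j * c ∈ W := by
  have h2 : (2 : K) ≠ 0 := by exact_mod_cast hchar 2 (by omega) (by omega)
  have hne1 : ∀ m : ℕ, 2 ≤ m → m < n → (m : K) ≠ 1 := by
    intro m hm hmn h
    refine hchar (m - 1) (by omega) (by omega) ?_
    rw [Nat.cast_sub (by omega), h]; simp
  have anti : Antitone (commIdeal K A) := antitone_nat_of_succ_le commIdeal_succ_le
  have hzero : ∀ {m : ℕ} {c : A}, n ≤ m → c ∈ commIdeal K A m → c = 0 := by
    intro m c hm hc
    have := anti (show n - 1 ≤ m by omega) hc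
    rwa [hnil, Submodule.mem_bot] at this
  have hspan := mem_span_proper_inf hU hW hc.1 hc.2
  clear hc
  induction hspan using Submodule.span_induction with
  | mem c hc =>
    obtain ⟨a, b, rfl, hc, hcW⟩ := hc
    have hnilc := hc.mem_commIdeal hgen h2
    by_cases ha : n ≤ a
    · rw [hzero ha hnilc.1]; simp
    by_cases hb : n ≤ b
    · rw [hzero hb hnilc.2]; simp
    -- Degree at least 3 excludes bidegree `(1, 1)`, that of `[x, y]`, for which the factor `2a(1 -
    -- a)` vanishes.
    rcases (by omega : 2 ≤ a ∨ 2 ≤ b) with h | h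
    · exact mono_mul_mem_of_left hgen hU h2 hW hc hcW hle (hchar a (by omega) (by omega))
        (hne1 a h (by omega)) i j
    · exact mono_mul_mem_of_right hgen hU h2 hW hc hcW hle (hchar b (by omega) (by omega))
        (hne1 b h (by omega)) i j
  | zero => simp
  | add b c _ _ hb hc => rw [mul_add]; exact add_mem hb hc
  | smul r b _ hb => rw [mul_smul_comm]; exact W.smul_mem r hb

end Simplicity

/-! ### Composition chains and finite generation -/

section Chains

variable {K A : Type*} [Field K] [Ring A] [Algebra K A]

/-- `TChain U`: the subspace `U` is reached from `0` by a finite chain of T-spaces that are ideals,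
with factors containing no proper T-space. -/
inductive TChain : Submodule K A → Prop
  | bot : TChain ⊥
  | step {I J : Submodule K A} : TChain I → IsTSpace J → IsIdeal J → I < J →
      (∀ W : Submodule K A, IsTSpace W → I ≤ W → W ≤ J → W = I ∨ W = J) → TChain J

theorem isTSpace_bot : IsTSpace (⊥ : Submodule K A) := by
  intro φ u hu
  rw [Submodule.mem_bot] at hu ⊢
  rw [hu, map_zero]

theorem IsTSpace.sup {U W : Submodule K A} (hU : IsTSpace U) (hW : IsTSpace W) :
    IsTSpace (U ⊔ W) := by
  intro φ z hz
  obtain ⟨u, hu, w, hw, rfl⟩ := Submodule.mem_sup.1 hz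
  rw [map_add]
  exact Submodule.add_mem_sup (hU φ u hu) (hW φ w hw)

theorem IsTSpace.inf {U W : Submodule K A} (hU : IsTSpace U) (hW : IsTSpace W) :
    IsTSpace (U ⊓ W) := fun φ z hz => ⟨hU φ z hz.1, hW φ z hz.2⟩

theorem TChain.isTSpace {U : Submodule K A} (h : TChain U) : IsTSpace U := by
  cases h with
  | bot => exact isTSpace_bot
  | step _ h _ _ _ => exact h

theorem TChain.exists_series {U : Submodule K A} (h : TChain U) :
    ∃ (k : ℕ) (T : Fin (k + 1) → Submodule K A), IsTNormalSeries U k T := by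
  induction h with
  | bot =>
    refine ⟨0, fun _ => ⊥, ⟨⟨rfl, rfl, fun _ => isTSpace_bot, fun i => i.elim0,
      fun i => i.elim0⟩, fun _ a u hu => ?_⟩⟩
    rw [Submodule.mem_bot] at hu
    simp [hu]
  | @step I J _ hJ hJid hlt hsimple ih =>
    obtain ⟨k, T, hT⟩ := ih
    refine ⟨k + 1, Fin.cons J T, ⟨⟨Fin.cons_zero _ _, ?_, ?_, ?_, ?_⟩, ?_⟩⟩
    · rw [← Fin.succ_last, Fin.cons_succ, hT.last]
    · intro i
      refine Fin.cases ?_ (fun i => ?_) i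
      · rwa [Fin.cons_zero]
      · rw [Fin.cons_succ]; exact hT.isTSpace i
    · intro i
      refine Fin.cases ?_ (fun i => ?_) i
      · rw [Fin.cons_succ, Fin.castSucc_zero, Fin.cons_zero, hT.first]; exact hlt
      · rw [Fin.cons_succ, ← Fin.succ_castSucc, Fin.cons_succ]; exact hT.strict i
    · intro i
      refine Fin.cases ?_ (fun i => ?_) i
      · rw [Fin.cons_succ, Fin.castSucc_zero, Fin.cons_zero, hT.first]; exact hsimple
      · rw [Fin.cons_succ, ← Fin.succ_castSucc, Fin.cons_succ]; exact hT.simple_factor i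
    · intro i
      refine Fin.cases ?_ (fun i => ?_) i
      · rwa [Fin.cons_zero]
      · rw [Fin.cons_succ]; exact hT.isIdeal i

theorem tSpan_mono {S S' : Set A} (h : S ⊆ S') : (tSpan S : Submodule K A) ≤ tSpan S' :=
  (isLeast_tSpan S).2 ⟨(isLeast_tSpan S').1.1, h.trans (isLeast_tSpan S').1.2⟩

/-- Each step needs at most one more generator: if `u ∈ U` lies outside `I`, simplicity gives `I ⊔
tSpan {u} = J`, and then `U = (U ⊓ I) ⊔ tSpan {u}` by the modular law. -/
theorem TChain.isFinitelyGenerated {V : Submodule K A} (h : TChain V) :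
    ∀ U : Submodule K A, IsTSpace U → U ≤ V → IsFinitelyGenerated U := by
  classical
  induction h with
  | bot =>
    intro U _ hle
    refine ⟨∅, le_antisymm (hle.trans bot_le) ?_⟩
    simp [tSpan]
  | @step I J hI hJ _ hlt hsimple ih =>
    intro U hU hle
    obtain ⟨S, hS⟩ := ih (U ⊓ I) (hU.inf hI.isTSpace) inf_le_right
    by_cases hUI : U ≤ I
    · exact ⟨S, by rw [← hS, inf_eq_left.2 hUI]⟩
    obtain ⟨u, hu, huI⟩ := Set.not_subset.1 hUI
    have huT : u ∈ (tSpan {u} : Submodule K A) := (isLeast_tSpan {u}).1.2 rfl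
    have huU : (tSpan {u} : Submodule K A) ≤ U :=
      (isLeast_tSpan {u}).2 ⟨hU, Set.singleton_subset_iff.2 hu⟩
    have hW := hsimple (I ⊔ tSpan {u}) (hI.isTSpace.sup (isLeast_tSpan {u}).1.1) le_sup_left
      (sup_le hlt.le (huU.trans hle))
    rcases hW with hW | hW
    · exact absurd (hW ▸ (le_sup_right : tSpan {u} ≤ I ⊔ tSpan {u}) huT) huI
    refine ⟨insert u S, le_antisymm ?_ ?_⟩
    · intro z hz
      have hzJ := hle hz
      rw [← hW] at hzJ
      obtain ⟨v, hv, w, hw, rfl⟩ := Submodule.mem_sup.1 hzJ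
      have hvU : v ∈ U := by
        have := sub_mem hz (huU hw)
        rwa [add_sub_cancel_right] at this
      have hvS : v ∈ (tSpan (S : Set A) : Submodule K A) := hS ▸ ⟨hvU, hv⟩
      refine add_mem (tSpan_mono ?_ hvS) (tSpan_mono ?_ hw) <;> simp
    · refine (isLeast_tSpan _).2 ⟨hU, ?_⟩
      rw [Finset.coe_insert, Set.insert_subset_iff]
      refine ⟨hu, fun s hs => ?_⟩
      have : s ∈ U ⊓ I := hS ▸ (isLeast_tSpan (K := K) (S : Set A)).1.2 hs
      exact this.1

/-- A chain can be extended along an interval of T-spaces in which all T-spaces are ideals and which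
carries a strictly monotone function with values in `ℕ`. -/
theorem TChain.extend {B U : Submodule K A} (μ : Submodule K A → ℕ)
    (hμ : ∀ W W', IsTSpace W → IsTSpace W' → B ≤ W → W' ≤ U → W < W' → μ W < μ W')
    (hid : ∀ W, IsTSpace W → B ≤ W → W ≤ U → IsIdeal W) (hU : IsTSpace U) :
    ∀ I : Submodule K A, TChain I → B ≤ I → I ≤ U → TChain U := by
  suffices h : ∀ d, ∀ I : Submodule K A, μ U - μ I = d → TChain I → B ≤ I → I ≤ U → TChain U from
    fun I => h _ I rfl
  intro d
  induction d using Nat.strong_induction_on with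
  | _ d ih =>
    intro I hd hI hBI hIU
    rcases hIU.eq_or_lt with rfl | hlt
    · exact hI
    let Q : Set (Submodule K A) := {J | IsTSpace J ∧ I < J ∧ J ≤ U}
    -- A T-space above `I` with least `μ` has no T-space strictly between `I` and itself.
    obtain ⟨J, ⟨hJ, hIJ, hJU⟩, hmin⟩ := (measure μ).wf.has_min Q ⟨U, hU, hlt, le_rfl⟩
    have hIJμ := hμ I J hI.isTSpace hJ hBI hJU hIJ
    have hJUμ : μ J ≤ μ U := by
      rcases hJU.eq_or_lt with rfl | h
      · exact le_rfl
      · exact (hμ J U hJ hU (hBI.trans hIJ.le) le_rfl h).le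
    refine ih (μ U - μ J) (by omega) J rfl ?_ (hBI.trans hIJ.le) hJU
    refine hI.step hJ (hid J hJ (hBI.trans hIJ.le) hJU) hIJ fun W hW hIW hWJ => ?_
    by_contra! hne
    have h1 : W < J := lt_of_le_of_ne hWJ hne.2
    refine hmin W ⟨hW, lt_of_le_of_ne hIW hne.1.symm, hWJ.trans hJU⟩ ?_
    exact hμ W J hW hJ (hBI.trans hIW) hJU h1

open Polynomial in
-- Within one layer, a T-space is recovered from its intersection with the proper elements, so the
-- dimension of this intersection is strictly monotone. The layers are stacked upwards from weight
-- `2 * n`, where the filtration is already zero.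
theorem tChain_propFil [Infinite K] {x y : A} (hgen : Algebra.adjoin K {x, y} = ⊤)
    (hU : ∀ f g : A[X], ∃ φ : A →ₐ[K] A[X], φ x = f ∧ φ y = g) {n : ℕ} (hn : 4 ≤ n)
    (hnil : commIdeal K A (n - 1) = ⊥) (hchar : ∀ m : ℕ, 0 < m → m < n → (m : K) ≠ 0) :
    TChain (propFil K A 3) := by
  have h2 : (2 : K) ≠ 0 := by exact_mod_cast hchar 2 (by omega) (by omega)
  have hbot : propFil K A (2 * n) = ⊥ :=
    eq_bot_iff.2 ((propFil_le_commIdeal hgen h2 (d := n - 1) (by omega)).trans hnil.le)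
  suffices h : ∀ d, ∀ e, 3 ≤ e → e + d = 2 * n → TChain (propFil K A e) from
    h (2 * n - 3) 3 le_rfl (by omega)
  intro d
  induction d with
  | zero =>
    intro e _ he
    rw [add_zero] at he
    rw [he, hbot]
    exact TChain.bot
  | succ d ih =>
    intro e he hed
    have hmono : ∀ W : Submodule K A, IsTSpace W → propFil K A (e + 1) ≤ W →
        ∀ c ∈ properSpace K x y e ⊓ W, ∀ i j, x ^ i * y ^ j * c ∈ W :=
      fun W hW hle c hc i j => mono_mul_mem hgen hU hn hnil hchar hW he hle hc i j
    refine TChain.extend (B := propFil K A (e + 1))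
      (fun W => Module.finrank K ↥(properSpace K x y e ⊓ W)) ?_ ?_ (isTSpace_propFil e) _
      (ih (e + 1) (by omega) (by omega)) le_rfl (propFil_succ_le e)
    · intro W W' hW hW' hle hge hlt
      refine Submodule.finrank_lt_finrank_of_lt (lt_of_le_of_ne (inf_le_inf_left _ hlt.le) ?_)
      intro heq
      have h := tSpace_le_monoSpan hgen hU hW' (hle.trans hlt.le) hge
        (hmono W' hW' (hle.trans hlt.le))
      rw [← heq] at h
      refine hlt.not_ge (h.trans (sup_le (Submodule.span_le.2 ?_) hle))
      rintro _ ⟨i, j, c, hc, rfl⟩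
      exact hmono W hW hle c hc i j
    · intro W hW hle hge
      exact isIdeal_of_le_monoSpan hgen hle hge (hmono W hW hle)
        (tSpace_le_monoSpan hgen hU hW hle hge (hmono W hW hle))

end Chains

/-! ### The relatively free algebra of rank two -/

section Identification

variable {K A : Type*} [Field K] [Ring A] [Algebra K A]

theorem map_longComm {B F : Type*} [Ring B] [FunLike F A B] [RingHomClass F A B] (φ : F)
    (v : ℕ → A) : ∀ m, φ (longComm v m) = longComm (fun i => φ (v i)) m
  | 0 => map_zero φ
  | 1 => rfl
  | m + 2 => by rw [longComm, longComm, map_lie, map_longComm φ v (m + 1)]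

theorem longComm_congr {v w : ℕ → A} : ∀ m, (∀ i < m, v i = w i) → longComm v m = longComm w m
  | 0, _ => rfl
  | 1, h => h 0 (by omega)
  | m + 2, h => by
    rw [longComm, longComm, longComm_congr (m + 1) fun i hi => h i (by omega), h (m + 1) (by omega)]

theorem longComm_mem_lowerComm (v : ℕ → A) : ∀ d, longComm v (d + 1) ∈ lowerComm K A d
  | 0 => Submodule.mem_top
  | d + 1 => lie_mem_lowerComm (longComm_mem_lowerComm v d) _

theorem lowerComm_le_span (d : ℕ) :
    lowerComm K A d ≤ Submodule.span K {z | ∃ v : ℕ → A, z = longComm v (d + 1)} := by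
  induction d with
  | zero => exact fun z _ => Submodule.subset_span ⟨fun _ => z, rfl⟩
  | succ d ih =>
    refine Submodule.span_le.2 ?_
    rintro _ ⟨u, hu, a, rfl⟩
    have hu' := ih hu
    clear hu
    refine SetLike.mem_coe.2 ?_
    induction hu' using Submodule.span_induction with
    | mem u hu =>
      obtain ⟨v, rfl⟩ := hu
      refine Submodule.subset_span ⟨Function.update v (d + 1) a, ?_⟩
      rw [longComm, Function.update_self]
      congr 1
      refine longComm_congr _ fun i hi => ?_
      rw [Function.update_of_ne (by omega)]
    | zero => simp
    | add b c _ _ hb hc => rw [add_lie]; exact add_mem hb hc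
    | smul r b _ hb => rw [smul_lie]; exact Submodule.smul_mem _ r hb

theorem lowerComm_eq_bot {d : ℕ} (h : ∀ v : ℕ → A, longComm v (d + 1) = 0) :
    lowerComm K A d = ⊥ := by
  refine eq_bot_iff.2 ((lowerComm_le_span d).trans (Submodule.span_le.2 ?_))
  rintro _ ⟨v, rfl⟩
  exact h v

open Polynomial in
-- `X` is central, so brackets expand coefficientwise. Thus `A[X]` inherits Lie nilpotency from `A`
-- and can be a target of the universal property.
theorem coeff_mem_lowerComm {d : ℕ} {p : A[X]} (hp : p ∈ lowerComm K A[X] d) (i : ℕ) :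
    p.coeff i ∈ lowerComm K A d := by
  induction d generalizing p i with
  | zero => exact Submodule.mem_top
  | succ d ih =>
    refine lowerComm_induction (P := fun p : A[X] => ∀ i, p.coeff i ∈ lowerComm K A (d + 1))
      (by simp) ?_ ?_ hp i
    · intro a b ha hb i; rw [coeff_add]; exact add_mem (ha i) (hb i)
    · intro u hu q i
      have h : ⁅u, q⁆.coeff i =
          ∑ z ∈ Finset.HasAntidiagonal.antidiagonal i, ⁅u.coeff z.1, q.coeff z.2⁆ := by
        rw [Ring.lie_def, coeff_sub, coeff_mul, coeff_mul,
          ← Finset.Nat.sum_antidiagonal_swap (f := fun z => q.coeff z.1 * u.coeff z.2),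
          ← Finset.sum_sub_distrib]
        rfl
      rw [h]
      exact sum_mem fun z _ => lie_mem_lowerComm (ih hu _) _

theorem longComm_mem_lieIdeal (v : ℕ → A) (n : ℕ) : longComm v n ∈ lieIdeal K A n := by
  refine TwoSidedIdeal.subset_span ⟨FreeAlgebra.lift K v, ?_⟩
  simp only [map_longComm, FreeAlgebra.lift_ι_apply]

theorem lieIdeal_le_iff {n : ℕ} {I : TwoSidedIdeal A} :
    lieIdeal K A n ≤ I ↔ ∀ v : ℕ → A, longComm v n ∈ I := by
  refine ⟨fun h v => h (longComm_mem_lieIdeal v n), fun h => TwoSidedIdeal.span_le.2 ?_⟩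
  rintro _ ⟨φ, rfl⟩
  simp only [map_longComm]
  exact h _

theorem mem_lieSubmodule {n : ℕ} {a : A} : a ∈ lieSubmodule K A n ↔ a ∈ lieIdeal K A n := Iff.rfl

/-- The term of weight 3 is an ideal containing all `[a, b, c]`. Conversely, weight 3 gives index
`⌈3 / 2⌉ = 2` in `commIdeal`, which is generated by such commutators. -/
theorem lieSubmodule_three {x y : A} (hgen : Algebra.adjoin K {x, y} = ⊤) (h2 : (2 : K) ≠ 0) :
    lieSubmodule K A 3 = propFil K A 3 := by
  refine le_antisymm ?_ ((propFil_le_commIdeal hgen h2 (d := 2) (by omega)).trans ?_)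
  · let I : TwoSidedIdeal A := TwoSidedIdeal.mk' (propFil K A 3) (zero_mem _) add_mem neg_mem
      (mul_mem_propFil _) (fun h => propFil_mul_mem' h _)
    have hI : ∀ {z : A}, z ∈ I ↔ z ∈ propFil K A 3 := TwoSidedIdeal.mem_mk' _ _ _ _ _ _ _
    have h : lieIdeal K A 3 ≤ I := lieIdeal_le_iff.2 fun v =>
      hI.2 (lie_mem_propFil (comm_mem_propFil (v 0) (v 1)) (v 2))
    exact fun z hz => hI.1 (h hz)
  · refine Submodule.span_le.2 ?_
    rintro _ ⟨a, u, hu, rfl⟩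
    have hle : lowerComm K A 2 ≤ lieSubmodule K A 3 := by
      refine (lowerComm_le_span 2).trans (Submodule.span_le.2 ?_)
      rintro _ ⟨v, rfl⟩
      exact longComm_mem_lieIdeal v 3
    exact (lieIdeal K A 3).mul_mem_left _ _ (mem_lieSubmodule.1 (hle hu))

variable (K)

theorem longComm_relFree (n : ℕ) (v : ℕ → RelFree K n) : longComm v n = 0 := by
  choose w hw using fun i => (lieIdeal K (FreeAlgebra K ℕ) n).ringCon.mk'_surjective (v i)
  have h : (lieIdeal K (FreeAlgebra K ℕ) n).ringCon.mk' (longComm w n) = 0 := by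
    rw [← map_zero (lieIdeal K (FreeAlgebra K ℕ) n).ringCon.mk']
    exact (RingCon.eq _).2 (longComm_mem_lieIdeal w n)
  rw [map_longComm] at h
  simpa only [hw] using h

theorem exists_relFree_hom {B : Type*} [Ring B] [Algebra K B] {n : ℕ}
    (hB : ∀ v : ℕ → B, longComm v n = 0) (b : ℕ → B) :
    ∃ φ : RelFree K n →ₐ[K] B, ∀ i, φ (RelFree.gen K n i) = b i := by
  have hker : (lieIdeal K (FreeAlgebra K ℕ) n).ringCon ≤
      RingCon.ker (FreeAlgebra.lift K b).toRingHom := by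
    intro a c hac
    have hle : lieIdeal K (FreeAlgebra K ℕ) n ≤ TwoSidedIdeal.ker (FreeAlgebra.lift K b) :=
      lieIdeal_le_iff.2 fun v => by
        rw [TwoSidedIdeal.mem_ker, map_longComm]; exact hB _
    have h := hle ((TwoSidedIdeal.rel_iff _ _ _).1 hac)
    rw [TwoSidedIdeal.mem_ker, map_sub, sub_eq_zero] at h
    exact h
  refine ⟨RingCon.liftₐ _ (FreeAlgebra.lift K b) hker, fun i => ?_⟩
  exact (RingCon.liftₐ_mk _ _ hker _).trans (FreeAlgebra.lift_ι_apply _ _)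

/-- The images of the free generators in the relatively free algebra of rank two. -/
def RelFreeTwo.gen (n : ℕ) (i : Fin 2) : RelFreeTwo K n :=
  ⟨RelFree.gen K n i, Algebra.subset_adjoin (by fin_cases i <;> simp)⟩

theorem adjoin_relFreeTwo_gen (n : ℕ) :
    Algebra.adjoin K {RelFreeTwo.gen K n 0, RelFreeTwo.gen K n 1} = ⊤ := by
  have h := Algebra.adjoin_adjoin_coe_preimage (R := K)
    (s := {RelFree.gen K n 0, RelFree.gen K n 1})
  refine Eq.trans (congrArg (Algebra.adjoin K) ?_) h
  ext z
  simp only [RelFreeTwo.gen, Set.mem_insert_iff, Set.mem_singleton_iff, Subtype.ext_iff]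
  rfl

theorem lowerComm_relFreeTwo {n : ℕ} (hn : 1 ≤ n) : lowerComm K (RelFreeTwo K n) (n - 1) = ⊥ := by
  refine lowerComm_eq_bot fun v => ?_
  rw [Nat.sub_add_cancel hn]
  have h := longComm_relFree K n fun i => (RelFreeTwo K n).val (v i)
  rw [← map_longComm] at h
  exact Subtype.ext h

open Polynomial in
theorem exists_relFreeTwo_hom {n : ℕ} (hn : 1 ≤ n) (f g : (RelFreeTwo K n)[X]) :
    ∃ φ : RelFreeTwo K n →ₐ[K] (RelFreeTwo K n)[X],
      φ (RelFreeTwo.gen K n 0) = f ∧ φ (RelFreeTwo.gen K n 1) = g := by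
  have hB : ∀ v : ℕ → (RelFreeTwo K n)[X], longComm v n = 0 := by
    intro v
    ext1 i
    have h := coeff_mem_lowerComm (longComm_mem_lowerComm (K := K) v (n - 1)) i
    rwa [lowerComm_relFreeTwo K hn, Submodule.mem_bot, Nat.sub_add_cancel hn] at h
  -- The images of the generators beyond the first two are immaterial, since `φ` is restricted to
  -- the subalgebra.
  obtain ⟨φ, hφ⟩ := exists_relFree_hom K hB fun i => if i = 0 then f else g
  exact ⟨φ.comp (RelFreeTwo K n).val, (hφ 0).trans (if_pos rfl), (hφ 1).trans (if_neg one_ne_zero)⟩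

end Identification
end LieNilpotent

open LieNilpotent in
theorem mainTheorem6 (K : Type*) [Field K] [Infinite K] (p n : ℕ) [CharP K p]
    (hn : 4 ≤ n) (hp : n ≤ p) :
    (∃ (k : ℕ) (T : Fin (k + 1) → Submodule K (RelFreeTwo K n)),
      IsTNormalSeries (lieSubmodule K (RelFreeTwo K n) 3) k T) ∧
    ∀ U : Submodule K (RelFreeTwo K n), IsTSpace U →
      U ≤ lieSubmodule K (RelFreeTwo K n) 3 → IsFinitelyGenerated U := by
  -- This is the only use of `n ≤ p`: the degrees occurring as scalars are smaller than `p`.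
  have hchar : ∀ m : ℕ, 0 < m → m < n → (m : K) ≠ 0 := by
    intro m hm hmn h
    have := Nat.le_of_dvd hm ((CharP.cast_eq_zero_iff K p m).1 h)
    omega
  have h2 : (2 : K) ≠ 0 := by exact_mod_cast hchar 2 (by omega) (by omega)
  have hnil : commIdeal K (RelFreeTwo K n) (n - 1) = ⊥ := by
    refine eq_bot_iff.2 (Submodule.span_le.2 ?_)
    rintro _ ⟨a, u, hu, rfl⟩
    rw [lowerComm_relFreeTwo K (by omega), Submodule.mem_bot] at hu
    simp [hu]
  have hchain := tChain_propFil (adjoin_relFreeTwo_gen K n)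
    (exists_relFreeTwo_hom K (by omega)) hn hnil hchar
  rw [← lieSubmodule_three (adjoin_relFreeTwo_gen K n) h2] at hchain
  exact ⟨hchain.exists_series, hchain.isFinitelyGenerated⟩
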